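/- For $d\ge 0$ let $T_d$ be the $d$-regular rooted tree, whose vertices are the finite words over the alphabet $X=\{0,\dots,d-1\}$ and whose root is the empty word, and let $\mathrm{Aut}(T_d)$ be its automorphism group, i.e. the group of bijections of the set of words that preserve length and the prefix relation. For $g\in\mathrm{Aut}(T_d)$ and a word $v$, the state $g|_v\in\mathrm{Aut}(T_d)$ is defined by $g(vw)=g(v)\,g|_v(w)$ for all words $w$. The automorphism $g$ is \emph{bounded} if it has finitely many different states and the numbers $\theta_k(g)=|\{v\in X^k : g|_v \text{ acts non-trivially on } X\}|$, $k\ge 0$, are bounded independently of $k$. The bounded automorphisms form a subgroup $\mathrm{Pol}(0)$ of $\mathrm{Aut}(T_d)$, the group of bounded automata. \textbf{Theorem.} The (simultaneous) conjugacy problem in the group of bounded automata is decidable. That is, there is an algorithm which, given $d$ and two tuples $(a_1,\dots,a_k)$ and $(b_1,\dots,b_k)$ of elements of $\mathrm{Pol}(0)$ of the same arbitrary length $k$, each element being given by a finite input-output automaton (a transition table with an initial state) that computes its action on words, decides whether there exists $h\in\mathrm{Pol}(0)$ such that $h^{-1}a_ih=b_i$ for all $i=1,\dots,k$. The case $k=1$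 is the conjugacy problem. -/

import Mathlib

/-- The automorphism group of the `d`-regular rooted tree, as a subgroup of the group of all
permutations of the vertices. The vertices are the finite words over the alphabet `Fin d`, the root
is the empty word, and an automorphism is a bijection of the set of vertices which preserves levels
and the prefix relation. -/
def treeAutSubgroup (d : ℕ) : Subgroup (Equiv.Perm (List (Fin d))) where
  carrier := {g | (∀ v, (g v).length = v.length) ∧ ∀ u v, u <+: v → g u <+: g v}
  one_mem' := ⟨fun _ => rfl, fun _ _ h => h⟩
  mul_mem' := by
    rintro g h ⟨hg, hg'⟩ ⟨hh, hh'⟩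
    exact ⟨fun v => by simp [Equiv.Perm.mul_apply, hg, hh],
      fun u v huv => hg' _ _ (hh' _ _ huv)⟩
  inv_mem' := by
    rintro g ⟨hg, hg'⟩
    have hlen : ∀ v, (g⁻¹ v).length = v.length := fun v => by
      have := hg (g⁻¹ v)
      rw [show g (g⁻¹ v) = v from Equiv.apply_symm_apply g v] at this
      exact this.symm
    refine ⟨hlen, fun u v huv => ?_⟩
    have h1 : (g⁻¹ v).take u.length <+: g⁻¹ v := List.take_prefix _ _
    have h2 := hg' _ _ h1
    rw [show g (g⁻¹ v) = v from Equiv.apply_symm_apply g v] at h2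
    have h3 : (g ((g⁻¹ v).take u.length)).length = u.length := by
      rw [hg, List.length_take, hlen]
      exact min_eq_left huv.length_le
    have h4 : g ((g⁻¹ v).take u.length) = u :=
      (List.prefix_of_prefix_length_le h2 huv h3.le).eq_of_length h3
    have h5 : g⁻¹ u = (g⁻¹ v).take u.length := by
      rw [Equiv.Perm.inv_eq_iff_eq, h4]
    rw [h5]
    exact h1

/-- The group of automorphisms of the `d`-regular rooted tree. -/
abbrev TreeAut (d : ℕ) : Type := treeAutSubgroup d

namespace TreeAut

variable {d : ℕ}

/-- The image of a vertex under a tree automorphism. -/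
def act (g : TreeAut d) (v : List (Fin d)) : List (Fin d) := (g : Equiv.Perm (List (Fin d))) v

theorem act_mul (g h : TreeAut d) (v : List (Fin d)) : (g * h).act v = g.act (h.act v) := rfl

theorem act_one (v : List (Fin d)) : (1 : TreeAut d).act v = v := rfl

theorem act_inv_act (g : TreeAut d) (v : List (Fin d)) : g⁻¹.act (g.act v) = v :=
  Equiv.symm_apply_apply _ _

theorem act_act_inv (g : TreeAut d) (v : List (Fin d)) : g.act (g⁻¹.act v) = v :=
  Equiv.apply_symm_apply _ _

theorem length_act (g : TreeAut d) (v : List (Fin d)) : (g.act v).length = v.length :=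
  g.2.1 v

theorem act_prefix (g : TreeAut d) {u v : List (Fin d)} (h : u <+: v) : g.act u <+: g.act v :=
  g.2.2 u v h

theorem ext_act {g h : TreeAut d} (H : ∀ v, g.act v = h.act v) : g = h :=
  Subtype.ext (Equiv.ext H)

/-- The action of the state of `g` at `v` on words. -/
def stateFun (g : TreeAut d) (v w : List (Fin d)) : List (Fin d) :=
  (g.act (v ++ w)).drop v.length

theorem act_append_stateFun (g : TreeAut d) (v w : List (Fin d)) :
    g.act (v ++ w) = g.act v ++ stateFun g v w := by
  obtain ⟨t, ht⟩ := g.act_prefix (List.prefix_append v w)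
  unfold stateFun
  rw [← ht, ← g.length_act v, List.drop_left]

theorem stateFun_inv (g : TreeAut d) (v w : List (Fin d)) :
    stateFun g⁻¹ (g.act v) (stateFun g v w) = w := by
  have h := act_append_stateFun g⁻¹ (g.act v) (stateFun g v w)
  rw [← act_append_stateFun, act_inv_act, act_inv_act] at h
  exact (List.append_cancel_left h).symm

/-- The state `g|_v` of `g` at the vertex `v`: the unique automorphism with
`g (v w) = g (v) g|_v (w)` for all words `w`. -/
def state (g : TreeAut d) (v : List (Fin d)) : TreeAut d :=
  ⟨{ toFun := stateFun g v
     invFun := stateFun g⁻¹ (g.act v)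
     left_inv := stateFun_inv g v
     right_inv := fun w => by
       have h := stateFun_inv g⁻¹ (g.act v) w
       rwa [inv_inv, act_inv_act] at h },
   fun w => by
     have h := congrArg List.length (act_append_stateFun g v w)
     simp only [length_act, List.length_append] at h
     exact (Nat.add_left_cancel h).symm,
   fun u w huw => by
     have h := g.act_prefix ((List.prefix_append_right_inj v).2 huw)
     rw [act_append_stateFun, act_append_stateFun] at h
     exact (List.prefix_append_right_inj _).1 h⟩

theorem act_append (g : TreeAut d) (v w : List (Fin d)) :
    g.act (v ++ w) = g.act v ++ (g.state v).act w :=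
  act_append_stateFun g v w

theorem state_one (v : List (Fin d)) : (1 : TreeAut d).state v = 1 := by
  refine ext_act fun w => ?_
  have h := act_append (1 : TreeAut d) v w
  rw [act_one, act_one] at h
  exact (List.append_cancel_left h).symm

theorem state_mul (g h : TreeAut d) (v : List (Fin d)) :
    (g * h).state v = g.state (h.act v) * h.state v := by
  refine ext_act fun w => ?_
  have H := act_append (g * h) v w
  rw [act_mul, act_append, act_append, act_mul] at H
  exact (List.append_cancel_left H).symm

theorem state_inv (g : TreeAut d) (v : List (Fin d)) :
    g⁻¹.state v = (g.state (g⁻¹.act v))⁻¹ := by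
  rw [eq_inv_iff_mul_eq_one]
  have h := state_mul g⁻¹ g (g⁻¹.act v)
  rw [act_act_inv, inv_mul_cancel, state_one] at h
  exact h.symm

/-- `g` is finite-state if it has only finitely many different states. -/
def IsFiniteState (g : TreeAut d) : Prop := (Set.range g.state).Finite

/-- `g` acts non-trivially on the first level of the tree. -/
def IsActive (g : TreeAut d) : Prop := ∃ x : Fin d, g.act [x] ≠ [x]

/-- The set of vertices of level `k` at which the state of `g` is active. -/
def activeSet (k : ℕ) (g : TreeAut d) : Set (List (Fin d)) :=
  {v | v.length = k ∧ (g.state v).IsActive}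

theorem activeSet_finite (k : ℕ) (g : TreeAut d) : (activeSet k g).Finite :=
  (List.finite_length_eq (Fin d) k).subset fun _ h => h.1

/-- The activity `θ_k(g)`: the number of words `v` of length `k` such that `g|_v` acts
non-trivially on the alphabet. -/
noncomputable def activity (k : ℕ) (g : TreeAut d) : ℕ := (activeSet k g).ncard

theorem not_isActive_one : ¬ (1 : TreeAut d).IsActive := fun ⟨_, h⟩ => h rfl

theorem IsActive.of_mul {g h : TreeAut d} (H : (g * h).IsActive) : g.IsActive ∨ h.IsActive := by
  obtain ⟨x, hx⟩ := H
  by_cases hh : h.act [x] = [x]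
  · exact Or.inl ⟨x, by rwa [act_mul, hh] at hx⟩
  · exact Or.inr ⟨x, hh⟩

theorem IsActive.of_inv {g : TreeAut d} (H : g⁻¹.IsActive) : g.IsActive := by
  obtain ⟨x, hx⟩ := H
  refine ⟨x, fun h => hx ?_⟩
  conv_lhs => rw [← h]
  exact act_inv_act g [x]

theorem activity_mul_le (k : ℕ) (g h : TreeAut d) :
    activity k (g * h) ≤ activity k g + activity k h := by
  have hsub : activeSet k (g * h) ⊆ (h⁻¹.act '' activeSet k g) ∪ activeSet k h := by
    rintro v ⟨hv, ha⟩
    rw [state_mul] at ha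
    rcases ha.of_mul with ha | ha
    · exact Or.inl ⟨h.act v, ⟨by rw [length_act, hv], ha⟩, act_inv_act h v⟩
    · exact Or.inr ⟨hv, ha⟩
  have hfin : (h⁻¹.act '' activeSet k g).Finite := (activeSet_finite k g).image _
  calc activity k (g * h)
      ≤ ((h⁻¹.act '' activeSet k g) ∪ activeSet k h).ncard :=
        Set.ncard_le_ncard hsub (hfin.union (activeSet_finite k h))
    _ ≤ (h⁻¹.act '' activeSet k g).ncard + (activeSet k h).ncard := Set.ncard_union_le _ _
    _ ≤ activity k g + activity k h :=
        Nat.add_le_add_right (Set.ncard_image_le (activeSet_finite k g)) _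

theorem activity_inv_le (k : ℕ) (g : TreeAut d) : activity k g⁻¹ ≤ activity k g := by
  have hsub : activeSet k g⁻¹ ⊆ g.act '' activeSet k g := by
    rintro v ⟨hv, ha⟩
    rw [state_inv] at ha
    exact ⟨g⁻¹.act v, ⟨by rw [length_act, hv], ha.of_inv⟩, act_act_inv g v⟩
  exact (Set.ncard_le_ncard hsub ((activeSet_finite k g).image _)).trans
    (Set.ncard_image_le (activeSet_finite k g))

/-- `g` is bounded if it is finite-state and the sequence `θ_k(g)` is bounded. -/
def IsBounded (g : TreeAut d) : Prop :=
  g.IsFiniteState ∧ ∃ C : ℕ, ∀ k : ℕ, activity k g ≤ C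

end TreeAut

/-- The group `Pol(0)` of bounded automata over an alphabet with `d` letters. -/
def PolZero (d : ℕ) : Subgroup (TreeAut d) where
  carrier := {g | g.IsBounded}
  one_mem' := by
    refine ⟨(Set.finite_singleton (1 : TreeAut d)).subset ?_, 0, fun k => ?_⟩
    · rintro _ ⟨v, rfl⟩
      exact TreeAut.state_one v
    · refine le_of_eq ((Set.ncard_eq_zero (TreeAut.activeSet_finite k _)).2 ?_)
      refine Set.eq_empty_of_forall_notMem ?_
      rintro v ⟨-, hv⟩
      rw [TreeAut.state_one] at hv
      exact TreeAut.not_isActive_one hv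
  mul_mem' := by
    rintro g h ⟨hg, C, hC⟩ ⟨hh, D, hD⟩
    refine ⟨(hg.mul hh).subset ?_, C + D, fun k => ?_⟩
    · rintro _ ⟨v, rfl⟩
      rw [TreeAut.state_mul]
      exact Set.mul_mem_mul ⟨_, rfl⟩ ⟨_, rfl⟩
    · exact (TreeAut.activity_mul_le k g h).trans (Nat.add_le_add (hC k) (hD k))
  inv_mem' := by
    rintro g ⟨hg, C, hC⟩
    refine ⟨hg.inv.subset ?_, C, fun k => (TreeAut.activity_inv_le k g).trans (hC k)⟩
    rintro _ ⟨v, rfl⟩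
    rw [TreeAut.state_inv]
    exact Set.inv_mem_inv.2 ⟨_, rfl⟩

/-- A finite input-output automaton with a chosen initial state, as a finite string of numbers:
the transition table together with the number of the initial state. The states are the rows of the
table; the entry `(y, t)` of the row `s` at position `x` means that in the state `s`, on reading
the letter `x`, the automaton outputs the letter `y` and moves to the state `t`. -/
abbrev AutomatonCode : Type := List (List (ℕ × ℕ)) × ℕ

namespace AutomatonCode

/-- The output of the automaton with transition table `A` which is started in the state `s` and
reads the given word; it is undefined if the table lacks an entry that is needed. -/
def run (A : List (List (ℕ × ℕ))) : ℕ → List ℕ → Option (List ℕ)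
  | _, [] => some []
  | s, x :: w =>
    (A[s]?.bind fun row => row[x]?).bind fun e => (run A e.2 w).map fun u => e.1 :: u

/-- The automaton with code `c`, started in its initial state, transforms every word over the
alphabet with `d` letters into its image under `g`. -/
def Represents {d : ℕ} (c : AutomatonCode) (g : TreeAut d) : Prop :=
  ∀ w : List (Fin d),
    run c.1 c.2 (w.map Fin.val) = some ((g.act w).map Fin.val)

end AutomatonCode

/-! Decidability follows from a computable bound on the number of states of some bounded conjugator,
if one exists, together with a finite test that recognises bounded conjugators among automata of
that size.

The relation `h * b i = a i * h` restricts at every vertex `v` to an equation between the states of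
`h` at `b i (v)` and at `v`, with coefficients that are states of `b i` and `a i`. Since `a i` and
`b i` are bounded, on each level only boundedly many of these equations have a non-trivial
coefficient; all others identify two states of `h`. Making `h` trivial on the orbits which meet no
non-trivial coefficient (`trim`) gives a conjugator with at most `R + 1` different states on each
level, `R` explicit (`exists_conj_levelStates`). After numbering these states, the equations of a
level form one of finitely many systems (`EqSystem`), and `h` is an infinite path through them. A
repeated system allows the path to be closed to a lasso, and the automaton on the lasso solves the
same equations (`lasso_mul`).

Boundedness has to survive the closing. A state is immortal if it has non-trivial states on all
levels. Deep down in a bounded automorphism an immortal state has at most one immortal child, and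
mortal states die out. The loop is chosen so that the set of immortal classes is the same at both
ends and all mortal classes of its start die before its end (`IsTame`, `lasso_isBounded`). Both
properties are local once the finite sets of classes are recorded along the path, so the path can be
shortened without losing them; this bounds the number of states (`exists_isBounded_conj`).

For the test, boundedness of an automorphism with at most `m` states follows from a bound on its
non-trivial states on finitely many levels (`ncard_supp_le`), and the conjugacy equations need
checking on one level only (`eq_of_act_eq_on_level`). The search for such a certificate is primitive
recursive. -/

namespace TreeAut

variable {d : ℕ}

/-! ### Root permutations and states -/

theorem act_nil (g : TreeAut d) : g.act [] = [] :=
  List.eq_nil_of_length_eq_zero (g.length_act [])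

/-- The image of a letter under a tree automorphism. -/
def letter (g : TreeAut d) (x : Fin d) : Fin d :=
  (g.act [x]).head (by rw [← List.length_pos_iff, length_act]; exact Nat.one_pos)

theorem act_singleton (g : TreeAut d) (x : Fin d) : g.act [x] = [g.letter x] := by
  obtain ⟨y, hy⟩ := List.length_eq_one_iff.1 (g.length_act [x])
  simp only [letter, hy, List.head_cons]

theorem letter_inv_letter (g : TreeAut d) (x : Fin d) : g⁻¹.letter (g.letter x) = x := by
  have h := act_inv_act g [x]
  rw [act_singleton, act_singleton] at h
  exact List.singleton_inj.1 h

/-- The permutation of the alphabet induced by a tree automorphism. -/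
def rootPerm (g : TreeAut d) : Equiv.Perm (Fin d) where
  toFun := g.letter
  invFun := g⁻¹.letter
  left_inv := g.letter_inv_letter
  right_inv := fun x => by
    have h := g⁻¹.letter_inv_letter x
    rwa [inv_inv] at h

theorem act_letter (g : TreeAut d) (x : Fin d) : g.act [x] = [g.rootPerm x] :=
  g.act_singleton x

theorem rootPerm_one : (1 : TreeAut d).rootPerm = 1 := by
  ext x
  have h := act_letter (1 : TreeAut d) x
  rw [act_one] at h
  exact congrArg Fin.val (List.singleton_inj.1 h).symm

theorem rootPerm_mul (g h : TreeAut d) (x : Fin d) :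
    (g * h).rootPerm x = g.rootPerm (h.rootPerm x) := by
  have H := act_mul g h [x]
  rw [act_letter, act_letter, act_letter] at H
  exact List.singleton_inj.1 H

theorem isActive_iff {g : TreeAut d} : g.IsActive ↔ g.rootPerm ≠ 1 := by
  simp only [IsActive, act_letter, ne_eq, List.cons.injEq, and_true, Equiv.ext_iff,
    Equiv.Perm.one_apply, not_forall]

theorem state_nil (g : TreeAut d) : g.state [] = g :=
  ext_act fun w => by
    have h := act_append g [] w
    rw [act_nil] at h
    exact h.symm

theorem state_append (g : TreeAut d) (v w : List (Fin d)) :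
    g.state (v ++ w) = (g.state v).state w := by
  refine ext_act fun u => ?_
  have h1 := act_append g (v ++ w) u
  rw [List.append_assoc, act_append g v, act_append _ w, act_append g v w,
    List.append_assoc] at h1
  exact (List.append_cancel_left (List.append_cancel_left h1)).symm

theorem act_cons (g : TreeAut d) (x : Fin d) (w : List (Fin d)) :
    g.act (x :: w) = g.rootPerm x :: (g.state [x]).act w := by
  have h := act_append g [x] w
  rwa [act_letter] at h

theorem act_snoc (g : TreeAut d) (v : List (Fin d)) (x : Fin d) :
    g.act (v ++ [x]) = g.act v ++ [(g.state v).rootPerm x] := by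
  rw [act_append, act_letter]

theorem take_act (g : TreeAut d) (v : List (Fin d)) (n : ℕ) :
    (g.act v).take n = g.act (v.take n) := by
  conv_lhs => rw [← List.take_append_drop n v, act_append]
  rcases le_total n v.length with h | h
  · rw [List.take_append_of_le_length (by rw [length_act, List.length_take]; omega),
      List.take_of_length_le (by rw [length_act, List.length_take]; omega)]
  · simp [List.drop_eq_nil_of_le h, act_nil, List.take_of_length_le h, length_act, h]

theorem eq_one_of_rootPerm {g : TreeAut d} (h : ∀ v, (g.state v).rootPerm = 1) : g = 1 := by
  refine ext_act fun v => ?_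
  rw [act_one]
  induction v using List.reverseRecOn with
  | nil => exact g.act_nil
  | append_singleton v x ih => rw [act_snoc, ih, h, Equiv.Perm.one_apply]

theorem state_eq_one_of_prefix {g : TreeAut d} {v w : List (Fin d)} (hv : g.state v = 1)
    (h : v <+: w) : g.state w = 1 := by
  obtain ⟨t, rfl⟩ := h
  rw [state_append, hv, state_one]

/-- Two tree automorphisms which are related by a bisimulation are equal. -/
theorem eq_of_bisim (r : TreeAut d → TreeAut d → Prop)
    (hroot : ∀ g g', r g g' → ∀ x, g.rootPerm x = g'.rootPerm x)
    (hstep : ∀ g g', r g g' → ∀ x, r (g.state [x]) (g'.state [x])) {g g' : TreeAut d}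
    (h : r g g') : g = g' := by
  refine ext_act fun w => ?_
  induction w generalizing g g' with
  | nil => rw [act_nil, act_nil]
  | cons x w ih => rw [act_cons, act_cons, hroot _ _ h, ih (hstep _ _ h x)]

theorem mul_state_letter (g h : TreeAut d) (x : Fin d) :
    (g * h).state [x] = g.state [h.rootPerm x] * h.state [x] := by
  rw [state_mul, act_letter]

/-! ### Tree automorphisms defined by invertible automata -/

section Machine

variable {Q : Type*} (π : Q → Equiv.Perm (Fin d)) (δ : Q → Fin d → Q)

/-- The transformation of words by an invertible automaton with output `π` and transitions `δ`. -/
def machineFun : Q → List (Fin d) → List (Fin d)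
  | _, [] => []
  | q, x :: w => π q x :: machineFun (δ q x) w

/-- The inverse of the transformation by an invertible automaton. -/
def machineInv : Q → List (Fin d) → List (Fin d)
  | _, [] => []
  | q, x :: w => (π q).symm x :: machineInv (δ q ((π q).symm x)) w

/-- The tree automorphism of an invertible automaton with output `π` and transitions `δ` which is
started in the state `q`. -/
def machine (q : Q) : TreeAut d :=
  ⟨{ toFun := machineFun π δ q
     invFun := machineInv π δ q
     left_inv := fun w => by
       induction w generalizing q with
       | nil => rfl
       | cons x w ih => simp [machineFun, machineInv, ih]
     right_inv := fun w => by
       induction w generalizing q with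
       | nil => rfl
       | cons x w ih => simp [machineFun, machineInv, ih] },
   fun w => by
     change (machineFun π δ q w).length = _
     induction w generalizing q with
     | nil => rfl
     | cons x w ih => simp [machineFun, ih],
   fun u w huw => by
     change machineFun π δ q u <+: machineFun π δ q w
     induction u generalizing q w with
     | nil => exact List.nil_prefix
     | cons x u ih =>
       obtain ⟨t, rfl⟩ := huw
       simp only [List.cons_append, machineFun, List.cons_prefix_cons, true_and]
       exact ih _ _ (List.prefix_append _ _)⟩

theorem machine_act_cons (q : Q) (x : Fin d) (w : List (Fin d)) :
    (machine π δ q).act (x :: w) = π q x :: (machine π δ (δ q x)).act w := rfl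

theorem machine_rootPerm (q : Q) : (machine π δ q).rootPerm = π q := by
  ext x
  have h := act_letter (machine π δ q) x
  rw [machine_act_cons, act_nil] at h
  exact congrArg Fin.val (List.singleton_inj.1 h).symm

theorem machine_state_letter (q : Q) (x : Fin d) :
    (machine π δ q).state [x] = machine π δ (δ q x) :=
  ext_act fun w => by
    have h := act_cons (machine π δ q) x w
    rw [machine_act_cons] at h
    exact (List.cons.inj h).2.symm

theorem machine_state (q : Q) (v : List (Fin d)) :
    (machine π δ q).state v = machine π δ (v.foldl δ q) := by
  induction v generalizing q with
  | nil => rw [state_nil]; rfl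
  | cons x v ih => rw [List.foldl_cons, ← ih, ← machine_state_letter, ← state_append]; rfl

theorem machine_eq_one {q : Q} (h : ∀ v : List (Fin d), π (v.foldl δ q) = 1) :
    machine π δ q = 1 :=
  eq_one_of_rootPerm fun v => by rw [machine_state, machine_rootPerm, h]

end Machine

/-! ### Non-trivial and immortal states, and an effective criterion for boundedness -/

/-- The set of vertices of level `n` with a non-trivial state. -/
def supp (n : ℕ) (g : TreeAut d) : Set (List (Fin d)) := {v | v.length = n ∧ g.state v ≠ 1}

theorem finite_of_length {n : ℕ} {s : Set (List (Fin d))} (h : ∀ v ∈ s, v.length = n) :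
    s.Finite :=
  (List.finite_length_eq (Fin d) n).subset h

theorem supp_finite (n : ℕ) (g : TreeAut d) : (supp n g).Finite :=
  finite_of_length fun _ h => h.1

theorem ncard_length_eq (n : ℕ) : {v : List (Fin d) | v.length = n}.ncard = d ^ n := by
  have : {v : List (Fin d) | v.length = n} =
      Set.range (fun f : Fin n → Fin d => List.ofFn f) := by
    ext v
    constructor
    · rintro rfl
      exact ⟨v.get, List.ofFn_get v⟩
    · rintro ⟨f, rfl⟩
      simp
  rw [this, ← Nat.card_coe_set_eq, Nat.card_range_of_injective List.ofFn_injective]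
  simp

theorem activeSet_subset_supp (n : ℕ) (g : TreeAut d) : activeSet n g ⊆ supp n g :=
  fun _ hv => ⟨hv.1, fun h => not_isActive_one (h ▸ hv.2)⟩

theorem isBounded_of_supp {g : TreeAut d} (hg : g.IsFiniteState) {C : ℕ}
    (h : ∀ n, (supp n g).ncard ≤ C) : g.IsBounded :=
  ⟨hg, C, fun k =>
    (Set.ncard_le_ncard (activeSet_subset_supp k g) (supp_finite k g)).trans (h k)⟩

theorem exists_isActive_state {g : TreeAut d} (h : g ≠ 1) : ∃ v, (g.state v).IsActive := by
  by_contra! H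
  exact h (eq_one_of_rootPerm fun v => by simpa [isActive_iff] using H v)

/-- Each of the finitely many non-trivial states has an active state fewer than `K` levels below it.
So every vertex with a non-trivial state is a truncation of an active vertex on one of the next `K`
levels, counting its own. -/
theorem IsBounded.exists_supp_le {g : TreeAut d} (hg : g.IsBounded) :
    ∃ C, ∀ n, (supp n g).ncard ≤ C := by
  obtain ⟨hf, C, hC⟩ := hg
  have key : ∃ K : ℕ, ∀ s ∈ Set.range g.state, s ≠ 1 → ∃ v, v.length < K ∧ (s.state v).IsActive := by
    choose! v hv using fun s : TreeAut d => exists_isActive_state (g := s)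
    obtain ⟨K, hK⟩ := (hf.image fun s => (v s).length).bddAbove
    exact ⟨K + 1, fun s hs h1 =>
      ⟨v s, Nat.lt_succ_of_le (hK ⟨s, hs, rfl⟩), hv s h1⟩⟩
  obtain ⟨K, hK⟩ := key
  refine ⟨K * C, fun n => ?_⟩
  have hsub : supp n g ⊆ ⋃ k ∈ Finset.range K, List.take n '' activeSet (n + k) g := by
    rintro v ⟨hv, hne⟩
    obtain ⟨w, hw, ha⟩ := hK _ ⟨v, rfl⟩ hne
    simp only [Set.mem_iUnion]
    refine ⟨w.length, Finset.mem_range.2 hw, v ++ w, ⟨by simp [hv], ?_⟩, by simp [← hv]⟩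
    rwa [state_append]
  calc (supp n g).ncard ≤ _ := Set.ncard_le_ncard hsub
        (Set.Finite.biUnion (Finset.finite_toSet _) fun k _ => (activeSet_finite _ g).image _)
    _ ≤ ∑ k ∈ Finset.range K, (List.take n '' activeSet (n + k) g).ncard :=
        Finset.set_ncard_biUnion_le _ _
    _ ≤ ∑ k ∈ Finset.range K, C := Finset.sum_le_sum fun k _ =>
        (Set.ncard_image_le (activeSet_finite _ g)).trans (hC _)
    _ = K * C := by simp

/-- A tree automorphism is immortal if it has non-trivial states on every level. -/
def Immortal (g : TreeAut d) : Prop := ∀ k, ∃ w : List (Fin d), w.length = k ∧ g.state w ≠ 1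

/-- The set of vertices of level `n` with an immortal state. -/
def immortalSet (n : ℕ) (g : TreeAut d) : Set (List (Fin d)) :=
  {v | v.length = n ∧ (g.state v).Immortal}

theorem Immortal.ne_one {g : TreeAut d} (h : g.Immortal) : g ≠ 1 := by
  obtain ⟨w, -, hw⟩ := h 0
  rintro rfl
  exact hw (state_one w)

theorem immortalSet_subset_supp (n : ℕ) (g : TreeAut d) : immortalSet n g ⊆ supp n g :=
  fun _ h => ⟨h.1, h.2.ne_one⟩

theorem immortalSet_finite (n : ℕ) (g : TreeAut d) : (immortalSet n g).Finite :=
  finite_of_length fun _ h => h.1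

theorem Immortal.of_state {g : TreeAut d} {v : List (Fin d)} (h : (g.state v).Immortal) :
    g.Immortal := by
  intro k
  obtain ⟨w, hw, h1⟩ := h k
  rw [← state_append] at h1
  exact ⟨(v ++ w).take k, by simp [hw], fun h2 =>
    h1 (state_eq_one_of_prefix h2 (List.take_prefix _ _))⟩

theorem state_eq_one_of_level {g : TreeAut d} {k : ℕ}
    (h : ∀ w : List (Fin d), w.length = k → g.state w = 1) {w : List (Fin d)}
    (hw : k ≤ w.length) : g.state w = 1 :=
  state_eq_one_of_prefix (h (w.take k) (by simp [hw])) (List.take_prefix _ _)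

/-- König's argument: if all of the finitely many children died, their latest time of death would
bound the life of `g`. -/
theorem Immortal.exists_letter {g : TreeAut d} (h : g.Immortal) :
    ∃ x, (g.state [x]).Immortal := by
  by_contra! H
  simp only [Immortal, not_forall, not_exists, not_and, not_not] at H
  choose k hk using H
  obtain ⟨w, hw, hne⟩ := h (Finset.univ.sup k + 1)
  obtain _ | ⟨x, w⟩ := w
  · simp at hw
  · refine hne ?_
    rw [show x :: w = [x] ++ w from rfl, state_append]
    refine state_eq_one_of_level (hk x) ?_
    have := Finset.le_sup (f := k) (Finset.mem_univ x)
    simp only [List.length_cons] at hw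
    omega

theorem Immortal.exists_mem_immortalSet {g : TreeAut d} (h : g.Immortal) (n : ℕ) :
    ∃ w, w ∈ immortalSet n g := by
  induction n generalizing g with
  | zero => exact ⟨[], rfl, by rwa [state_nil]⟩
  | succ n ih =>
    obtain ⟨x, hx⟩ := h.exists_letter
    obtain ⟨w, hw, h1⟩ := ih hx
    exact ⟨x :: w, by simp [hw], by rwa [← state_append] at h1⟩

theorem immortal_of_state_eq {g : TreeAut d} (hg : g ≠ 1) {u : List (Fin d)} (hu : u ≠ [])
    (h : g.state u = g) : g.Immortal := by
  have hs : ∀ k, g.state (List.replicate k u).flatten = g := fun k => by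
    induction k with
    | zero => exact g.state_nil
    | succ k ih => rw [List.replicate_succ, List.flatten_cons, state_append, h, ih]
  intro k
  refine ⟨(List.replicate k u).flatten.take k, ?_, fun h1 => hg ?_⟩
  · have := List.length_pos_iff.2 hu
    simp only [List.length_take, List.length_flatten, List.map_replicate, List.sum_replicate,
      smul_eq_mul]
    exact min_eq_left (Nat.le_mul_of_pos_right _ this)
  · rw [← hs k]
    exact state_eq_one_of_prefix h1 (List.take_prefix _ _)

/-- Every turn around the loop `u` passes the side branch `w`, which contributes a further immortal
vertex. The growth is therefore at least linear, which boundedness excludes. -/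
theorem immortalSet_growth {g : TreeAut d} (hg : g.Immortal) {u w : List (Fin d)}
    (h : g.state u = g) (hw : w.length = u.length) (hne : w ≠ u) (hi : (g.state w).Immortal)
    (k : ℕ) : k + 1 ≤ (immortalSet (k * u.length) g).ncard := by
  induction k with
  | zero =>
    rw [Nat.succ_le_iff, Set.ncard_pos (immortalSet_finite _ _)]
    exact hg.exists_mem_immortalSet _
  | succ k ih =>
    obtain ⟨z, hz⟩ := hi.exists_mem_immortalSet (k * u.length)
    have hnot : w ++ z ∉ (u ++ ·) '' immortalSet (k * u.length) g := by
      rintro ⟨y, -, hy⟩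
      exact hne (List.append_inj_left hy hw.symm).symm
    have hfin := (immortalSet_finite (k * u.length) g).image (u ++ ·)
    have hsub : insert (w ++ z) ((u ++ ·) '' immortalSet (k * u.length) g) ⊆
        immortalSet ((k + 1) * u.length) g := by
      rintro v (rfl | ⟨y, hy, rfl⟩)
      · exact ⟨by rw [List.length_append, hw, hz.1]; ring, by rw [state_append]; exact hz.2⟩
      · exact ⟨by rw [List.length_append, hy.1]; ring, by rw [state_append, h]; exact hy.2⟩
    have h1 := Set.ncard_le_ncard hsub (immortalSet_finite _ _)
    rw [Set.ncard_insert_of_notMem hnot hfin,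
      Set.ncard_image_of_injective _ (List.append_right_injective u)] at h1
    omega

/-- Without a side branch, the only possible immortal vertices are the prefixes of the infinite
periodic word `u u u …`. -/
theorem immortalSet_subsingleton {g : TreeAut d} {u : List (Fin d)} (hu : u ≠ [])
    (h : g.state u = g)
    (huniq : ∀ w : List (Fin d), w.length = u.length → (g.state w).Immortal → w = u) (n : ℕ) :
    (immortalSet n g).Subsingleton := by
  have hp := List.length_pos_iff.2 hu
  induction n using Nat.strong_induction_on with
  | _ n ih =>
    rcases lt_or_ge n u.length with hn | hn
    · have key : ∀ w ∈ immortalSet n g, w = u.take n := fun w hw => by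
        obtain ⟨z, hz, hz'⟩ := hw.2.exists_mem_immortalSet (u.length - n)
        rw [← huniq (w ++ z) (by rw [List.length_append, hz, hw.1]; omega)
          (by rwa [state_append]), ← hw.1, List.take_left]
      intro w hw w' hw'
      rw [key w hw, key w' hw']
    · have key : ∀ w ∈ immortalSet n g,
          w.take u.length = u ∧ w.drop u.length ∈ immortalSet (n - u.length) g := fun w hw => by
        have h1 := hw.2
        rw [← List.take_append_drop u.length w, state_append] at h1
        have h2 := huniq _ (by rw [List.length_take, hw.1]; omega) h1.of_state
        rw [h2, h] at h1
        exact ⟨h2, by rw [List.length_drop, hw.1], h1⟩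
      intro w hw w' hw'
      rw [← List.take_append_drop u.length w, ← List.take_append_drop u.length w',
        (key w hw).1, (key w' hw').1,
        ih _ (by omega) (key w hw).2 (key w' hw').2]

theorem range_state_subset (g : TreeAut d) (v : List (Fin d)) :
    Set.range (g.state v).state ⊆ Set.range g.state := by
  rintro _ ⟨w, rfl⟩
  exact ⟨v ++ w, state_append _ _ _⟩

theorem exists_state_take_eq {g : TreeAut d} (hg : g.IsFiniteState) {m : ℕ}
    (hm : (Set.range g.state).ncard ≤ m) (v : List (Fin d)) :
    ∃ i j, i < j ∧ j ≤ m ∧ g.state (v.take i) = g.state (v.take j) := by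
  have hmaps : Set.MapsTo (fun i => g.state (v.take i)) (Finset.range (m + 1)) hg.toFinset :=
    fun i _ => hg.mem_toFinset.2 ⟨_, rfl⟩
  have hcard : hg.toFinset.card < (Finset.range (m + 1)).card := by
    rw [Finset.card_range, ← Set.ncard_eq_toFinset_card _ hg]
    omega
  obtain ⟨i, hi, j, hj, hne, h⟩ := Finset.exists_ne_map_eq_of_card_lt_of_maps_to hcard hmaps
  rw [Finset.mem_range] at hi hj
  rcases lt_or_gt_of_ne hne with h1 | h1
  · exact ⟨i, j, h1, by omega, h⟩
  · exact ⟨j, i, h1, by omega, h.symm⟩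

theorem exists_recurrent_prefix {g : TreeAut d} (hg : g.IsFiniteState) {m : ℕ}
    (hm : (Set.range g.state).ncard ≤ m) {v : List (Fin d)} (hv : m ≤ v.length) :
    ∃ w u z, v = w ++ u ++ z ∧ w.length + u.length ≤ m ∧ u ≠ [] ∧
      (g.state w).state u = g.state w := by
  obtain ⟨i, j, hij, hj, h⟩ := exists_state_take_eq hg hm v
  have h1 : v.take i ++ (v.take j).drop i = v.take j := by
    conv_rhs => rw [← List.take_append_drop i (v.take j)]
    rw [List.take_take, min_eq_left hij.le]
  refine ⟨v.take i, (v.take j).drop i, v.drop j, ?_, ?_, ?_, ?_⟩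
  · rw [h1, List.take_append_drop]
  · rw [← List.length_append, h1, List.length_take]
    omega
  · rw [← List.length_pos_iff, List.length_drop, List.length_take]
    omega
  · rw [← state_append, h1, h]

/-- The path to `v` repeats a state within its first `m` steps; this state lies on a loop and is
non-trivial, since a trivial one would have only trivial states below it. -/
theorem immortal_of_level_ne_one {g : TreeAut d} (hg : g.IsFiniteState) {m : ℕ}
    (hm : (Set.range g.state).ncard ≤ m) {v : List (Fin d)} (hv : m ≤ v.length)
    (h1 : g.state v ≠ 1) : g.Immortal := by
  obtain ⟨w, u, z, rfl, -, hu, h⟩ := exists_recurrent_prefix hg hm hv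
  refine (immortal_of_state_eq (fun h2 => h1 ?_) hu h).of_state
  rw [state_append, state_append, h2, state_one, state_one]

theorem immortalSet_state_subsingleton {g : TreeAut d} (hg : g.IsFiniteState) {m N : ℕ}
    (hm : (Set.range g.state).ncard ≤ m) (hN : ∀ n ≤ m * (N + 2), (supp n g).ncard ≤ N)
    {v : List (Fin d)} (hv : v.length = m) (n : ℕ) :
    (immortalSet n (g.state v)).Subsingleton := by
  obtain ⟨w, u, z, rfl, hle, hu, h⟩ := exists_recurrent_prefix hg hm hv.ge
  intro y hy y' hy'
  have hi : (g.state w).Immortal := by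
    have := hy.2.of_state
    rw [List.append_assoc, state_append] at this
    exact this.of_state
  have huniq : ∀ x : List (Fin d), x.length = u.length → ((g.state w).state x).Immortal →
      x = u := by
    by_contra! H
    obtain ⟨x, hx, hxi, hne⟩ := H
    -- A side branch of the loop would yield `N + 1` immortal vertices after `N` turns. The loop is
    -- reached within `m` letters and has length at most `m`, so this happens on a level covered by
    -- `hN`.
    have h1 := immortalSet_growth hi h hx hne hxi N
    have h2 : (immortalSet (N * u.length) (g.state w)).ncard ≤
        (supp (w.length + N * u.length) g).ncard :=
      Set.ncard_le_ncard_of_injOn (w ++ ·)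
        (fun x hx => ⟨by simp [hx.1], by rw [state_append]; exact hx.2.ne_one⟩)
        (List.append_right_injective w).injOn (supp_finite _ _)
    have h3 : w.length + N * u.length ≤ m * (N + 2) := by
      calc w.length + N * u.length ≤ m + N * m :=
            Nat.add_le_add (by omega) (Nat.mul_le_mul_left _ (by omega))
        _ ≤ m * (N + 2) := by nlinarith
    have := hN _ h3
    omega
  have key : ∀ x ∈ immortalSet n (g.state (w ++ u ++ z)),
      z ++ x ∈ immortalSet (z.length + n) (g.state w) := fun x hx => by
    refine ⟨by simp [hx.1], ?_⟩
    have := hx.2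
    rwa [state_append, state_append, h, ← state_append] at this
  exact List.append_cancel_left
    (immortalSet_subsingleton hu h huniq _ (key y hy) (key y' hy'))

theorem ncard_length_le {n m : ℕ} (h : n ≤ m) {s : Set (List (Fin d))}
    (hs : ∀ v ∈ s, v.length = n) : s.ncard ≤ (d + 1) ^ m :=
  calc s.ncard ≤ {v : List (Fin d) | v.length = n}.ncard :=
        Set.ncard_le_ncard hs (finite_of_length fun _ h => h)
    _ = d ^ n := ncard_length_eq n
    _ ≤ (d + 1) ^ n := Nat.pow_le_pow_left d.le_succ n
    _ ≤ (d + 1) ^ m := Nat.pow_le_pow_right d.succ_pos h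

/-- Beyond level `m` an immortal vertex is determined by its prefix of length `m`. -/
theorem ncard_immortalSet_le {g : TreeAut d} (hg : g.IsFiniteState) {m N : ℕ}
    (hm : (Set.range g.state).ncard ≤ m) (hN : ∀ n ≤ m * (N + 2), (supp n g).ncard ≤ N)
    (n : ℕ) : (immortalSet n g).ncard ≤ (d + 1) ^ m := by
  rcases le_total n m with h | h
  · exact ncard_length_le h fun v hv => hv.1
  · refine le_trans (Set.ncard_le_ncard_of_injOn (t := {v : List (Fin d) | v.length = m}) (List.take m)
      (fun v hv => ?_) (fun v hv v' hv' heq => ?_) (finite_of_length (n := m) fun _ h => h))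
      (ncard_length_le (n := m) le_rfl fun v hv => hv)
    · simp only [Set.mem_ofPred_eq, List.length_take, hv.1, h, min_eq_left]
    · have key : ∀ y ∈ immortalSet n g, y.drop m ∈ immortalSet (n - m) (g.state (y.take m)) :=
        fun y hy => ⟨by rw [List.length_drop, hy.1],
          by rw [← state_append, List.take_append_drop]; exact hy.2⟩
      have h1 := key v' hv'
      rw [← heq] at h1
      rw [← List.take_append_drop m v, ← List.take_append_drop m v', heq.symm,
        immortalSet_state_subsingleton hg hm hN (by simp [hv.1, h]) _ (key v hv) h1]

/-- If a tree automorphism with `m` states has few non-trivial states on the first levels, then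
the number of its non-trivial states is bounded on all levels by an explicit constant. -/
theorem ncard_supp_le {g : TreeAut d} (hg : g.IsFiniteState) {m N : ℕ}
    (hm : (Set.range g.state).ncard ≤ m) (hN : ∀ n ≤ m * (N + 2), (supp n g).ncard ≤ N)
    (n : ℕ) : (supp n g).ncard ≤ (d + 1) ^ (2 * m) := by
  rcases le_total n m with h | h
  · exact ncard_length_le (by omega) fun v hv => hv.1
  -- A state that still has a non-trivial state `m` levels further down is immortal, so the ancestor
  -- on level `n - m` of any vertex counted here is immortal.
  · have hsub : supp n g ⊆ (fun p : List (Fin d) × List (Fin d) => p.1 ++ p.2) ''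
        (immortalSet (n - m) g ×ˢ {v | v.length = m}) := by
      rintro v ⟨hv, hne⟩
      refine ⟨(v.take (n - m), v.drop (n - m)), ⟨⟨by simp [hv], ?_⟩, ?_⟩, by simp⟩
      · rw [← List.take_append_drop (n - m) v, state_append] at hne
        exact immortal_of_level_ne_one (hg.subset (range_state_subset _ _))
          ((Set.ncard_le_ncard (range_state_subset _ _) hg).trans hm)
          (by rw [List.length_drop, hv]; omega) hne
      · simp only [Set.mem_ofPred_eq, List.length_drop, hv]
        omega
    have hfin : (immortalSet (n - m) g ×ˢ {v : List (Fin d) | v.length = m}).Finite :=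
      (immortalSet_finite _ _).prod (finite_of_length fun _ h => h)
    calc (supp n g).ncard ≤ _ := Set.ncard_le_ncard hsub (hfin.image _)
      _ ≤ _ := Set.ncard_image_le hfin
      _ = (immortalSet (n - m) g).ncard * {v : List (Fin d) | v.length = m}.ncard :=
          Set.ncard_prod
      _ ≤ (d + 1) ^ m * (d + 1) ^ m := Nat.mul_le_mul (ncard_immortalSet_le hg hm hN _)
          (ncard_length_le le_rfl fun _ h => h)
      _ = (d + 1) ^ (2 * m) := by ring

theorem IsBounded.ncard_supp_le {g : TreeAut d} (hg : g.IsBounded) {m : ℕ}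
    (hm : (Set.range g.state).ncard ≤ m) (n : ℕ) : (supp n g).ncard ≤ (d + 1) ^ (2 * m) := by
  obtain ⟨C, hC⟩ := hg.exists_supp_le
  exact TreeAut.ncard_supp_le hg.1 hm (fun n _ => hC n) n

/-! ### Trimming a conjugator to few states on each level -/

section Conjugator

variable {ι : Type*} (a b : ι → TreeAut d) (h : TreeAut d)

/-- The vertex `v` is exceptional for the `i`-th conjugacy equation if the states of `b i` and
`a i` which occur in this equation at `v` are not both trivial. -/
def Exceptional (i : ι) (v : List (Fin d)) : Prop :=
  (b i).state v ≠ 1 ∨ (a i).state (h.act v) ≠ 1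

/-- Two vertices are adjacent if one is the image of the other under some `b i`. -/
def Adjacent (v w : List (Fin d)) : Prop := ∃ i, w = (b i).act v ∨ v = (b i).act w

/-- A vertex is touched if it is connected to an exceptional vertex. -/
def Touched (v : List (Fin d)) : Prop :=
  ∃ w, Relation.ReflTransGen (Adjacent b) v w ∧ ∃ i, Exceptional a b h i w

/-- The tree automorphism which acts as `h` at the touched vertices and trivially elsewhere. -/
noncomputable def trim : TreeAut d :=
  open Classical in
  machine (fun v => if Touched a b h v then (h.state v).rootPerm else 1)
    (fun v x => v ++ [x]) []

variable {a b h}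

theorem conj_state (H : ∀ i, h * b i = a i * h) (i : ι) (v : List (Fin d)) :
    h.state ((b i).act v) * (b i).state v = (a i).state (h.act v) * h.state v := by
  rw [← state_mul, H, state_mul]

theorem Exceptional.take {i : ι} {v : List (Fin d)} (n : ℕ)
    (hv : Exceptional a b h i v) : Exceptional a b h i (v.take n) := by
  refine hv.imp (fun h1 h2 => h1 ?_) (fun h1 h2 => h1 ?_)
  · exact state_eq_one_of_prefix h2 (List.take_prefix _ _)
  · exact state_eq_one_of_prefix h2 (h.act_prefix (List.take_prefix _ _))

theorem Adjacent.take {v w : List (Fin d)} (n : ℕ) (hv : Adjacent b v w) :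
    Adjacent b (v.take n) (w.take n) := by
  obtain ⟨i, rfl | rfl⟩ := hv
  · exact ⟨i, Or.inl (take_act _ _ _)⟩
  · exact ⟨i, Or.inr (take_act _ _ _)⟩

theorem Adjacent.length_eq {v w : List (Fin d)} (hv : Adjacent b v w) :
    v.length = w.length := by
  obtain ⟨i, rfl | rfl⟩ := hv
  · exact (length_act _ _).symm
  · exact length_act _ _

theorem Adjacent.symm {v w : List (Fin d)} (hv : Adjacent b v w) : Adjacent b w v := by
  obtain ⟨i, hi⟩ := hv
  exact ⟨i, hi.symm⟩

/-- Truncation preserves adjacency and exceptionality, so the touched vertices are closed under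
prefixes. Hence the trimmed automorphism agrees with `h` on all of them. -/
theorem Touched.of_append {v w : List (Fin d)} (hv : Touched a b h (v ++ w)) :
    Touched a b h v := by
  obtain ⟨u, hu, i, hi⟩ := hv
  refine ⟨u.take v.length, ?_, i, hi.take _⟩
  have := hu.lift (List.take v.length) fun _ _ hadj => Adjacent.take v.length hadj
  rwa [Function.onFun, List.take_left] at this

theorem Touched.of_adjacent {v w : List (Fin d)} (hw : Touched a b h w)
    (hvw : Adjacent b v w) : Touched a b h v := by
  obtain ⟨u, hu, hi⟩ := hw
  exact ⟨u, hu.head hvw, hi⟩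

theorem state_eq_one_of_not_touched {v : List (Fin d)} (hv : ¬ Touched a b h v) (i : ι) :
    (b i).state v = 1 ∧ (a i).state (h.act v) = 1 := by
  by_contra hne
  exact hv ⟨v, .refl, i, by rwa [Exceptional, ← not_and_or]⟩

open Classical in
theorem trim_rootPerm (v : List (Fin d)) : ((trim a b h).state v).rootPerm =
    if Touched a b h v then (h.state v).rootPerm else 1 := by
  have : v.foldl (fun (v : List (Fin d)) x => v ++ [x]) [] = v := by
    induction v using List.reverseRecOn with
    | nil => rfl
    | append_singleton v x ih => rw [List.foldl_append, ih]; rfl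
  rw [trim, machine_state, machine_rootPerm, this]

theorem trim_act_of_touched {v : List (Fin d)} (hv : Touched a b h v) :
    (trim a b h).act v = h.act v := by
  induction v using List.reverseRecOn with
  | nil => rw [act_nil, act_nil]
  | append_singleton v x ih =>
    rw [act_snoc, act_snoc, ih hv.of_append, trim_rootPerm, if_pos hv.of_append]

theorem trim_state_of_not_touched {v : List (Fin d)} (hv : ¬ Touched a b h v) :
    (trim a b h).state v = 1 :=
  eq_one_of_rootPerm fun w => by
    rw [← state_append, trim_rootPerm, if_neg fun hw => hv hw.of_append]

theorem trim_state_of_state {v : List (Fin d)} (hv : h.state v = 1) :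
    (trim a b h).state v = 1 :=
  eq_one_of_rootPerm fun w => by
    rw [← state_append, trim_rootPerm, state_append, hv, state_one, rootPerm_one, ite_self]

/-- At a topmost untouched vertex the parent, if any, is touched, so the trimmed automorphism and
`h` have the same image there and the state of `a i` is trivial. Triviality is inherited below,
where the two images may differ. -/
theorem state_trim_act {v : List (Fin d)} (hv : ¬ Touched a b h v) (i : ι) :
    (a i).state ((trim a b h).act v) = 1 := by
  induction v using List.reverseRecOn with
  | nil =>
    have := (state_eq_one_of_not_touched hv i).2
    rwa [act_nil] at this ⊢
  | append_singleton v x ih =>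
    by_cases hv' : Touched a b h v
    · rw [act_snoc, trim_act_of_touched hv', trim_rootPerm, if_pos hv', ← act_snoc]
      exact (state_eq_one_of_not_touched hv i).2
    · rw [act_snoc, state_append, ih hv', state_one]

/-- Touchedness is invariant under every `b i`. At touched vertices the equation is that of `h`; at
untouched ones both coefficients and both states of the trimmed automorphism are trivial. -/
theorem trim_conj (H : ∀ i, h * b i = a i * h) (i : ι) :
    trim a b h * b i = a i * trim a b h := by
  refine ext_act fun v => ?_
  rw [act_mul, act_mul]
  induction v using List.reverseRecOn with
  | nil => simp only [act_nil]
  | append_singleton v x ih =>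
    rw [act_snoc, act_snoc, act_snoc, act_snoc, ih, trim_rootPerm, trim_rootPerm]
    have hadj : Adjacent b v ((b i).act v) := ⟨i, Or.inl rfl⟩
    by_cases hv : Touched a b h v
    · rw [if_pos hv, if_pos (hv.of_adjacent hadj.symm), trim_act_of_touched hv,
        ← rootPerm_mul, conj_state H, rootPerm_mul]
    · rw [if_neg hv, if_neg fun hw => hv (hw.of_adjacent hadj), state_trim_act hv,
        (state_eq_one_of_not_touched hv i).1, rootPerm_one]

theorem trim_state_act (H : ∀ i, h * b i = a i * h) {i : ι} {v : List (Fin d)}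
    (hv : ¬ Exceptional a b h i v) :
    (trim a b h).state ((b i).act v) = (trim a b h).state v := by
  rw [Exceptional, not_or, not_not, not_not] at hv
  have e := conj_state (trim_conj H) i v
  have ha : (a i).state ((trim a b h).act v) = 1 := by
    by_cases ht : Touched a b h v
    · rw [trim_act_of_touched ht, hv.2]
    · exact state_trim_act ht i
  rwa [hv.1, ha, mul_one, one_mul] at e

/-- The set of states of `g` at the vertices of level `n`, together with the trivial state. -/
def levelStates (n : ℕ) (g : TreeAut d) : Set (TreeAut d) :=
  insert 1 (g.state '' {v | v.length = n})

/-- Along a chain from a touched vertex to an exceptional one, the state does not change across a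
non-exceptional edge. It is therefore carried to an end of the first exceptional edge, or to the
exceptional vertex at the end of the chain. -/
theorem levelStates_trim (H : ∀ i, h * b i = a i * h) (n : ℕ) :
    levelStates n (trim a b h) ⊆ insert 1 (⋃ i,
      ((trim a b h).state '' {v | v.length = n ∧ Exceptional a b h i v}) ∪
        (fun v => (trim a b h).state ((b i).act v)) ''
          {v | v.length = n ∧ Exceptional a b h i v}) := by
  rintro g (rfl | ⟨v, hv, rfl⟩)
  · exact Set.mem_insert _ _
  by_contra hg
  rw [Set.mem_insert_iff, not_or, Set.mem_iUnion, not_exists] at hg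
  obtain ⟨h1, h2⟩ := hg
  by_cases ht : Touched a b h v
  · obtain ⟨w, hw, i, hi⟩ := ht
    have key : w.length = n ∧ (trim a b h).state w = (trim a b h).state v := by
      clear hi
      induction hw with
      | refl => exact ⟨hv, rfl⟩
      | tail _ hadj ih =>
        refine ⟨hadj.length_eq ▸ ih.1, ih.2 ▸ ?_⟩
        rename_i u u' _
        obtain ⟨j, hj | hj⟩ := hadj <;> subst hj
        · exact trim_state_act H fun hx => h2 j (Or.inl ⟨u, ⟨ih.1, hx⟩, ih.2⟩)
        · exact (trim_state_act H fun hx =>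
            h2 j (Or.inr ⟨u', ⟨by rw [← ih.1, length_act], hx⟩, ih.2⟩)).symm
    exact h2 i (Or.inl ⟨w, ⟨key.1, hi⟩, key.2⟩)
  · exact h1 (trim_state_of_not_touched ht)

theorem ncard_exceptional_le {C : ℕ} (ha : ∀ i n, (supp n (a i)).ncard ≤ C)
    (hb : ∀ i n, (supp n (b i)).ncard ≤ C) (i : ι) (n : ℕ) :
    {v | v.length = n ∧ Exceptional a b h i v}.ncard ≤ 2 * C := by
  have hsub : {v | v.length = n ∧ Exceptional a b h i v} ⊆
      supp n (b i) ∪ h⁻¹.act '' supp n (a i) := by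
    rintro v ⟨hv, h1 | h1⟩
    · exact Or.inl ⟨hv, h1⟩
    · exact Or.inr ⟨h.act v, ⟨by rw [length_act, hv], h1⟩, act_inv_act _ _⟩
  calc _ ≤ (supp n (b i) ∪ h⁻¹.act '' supp n (a i)).ncard :=
        Set.ncard_le_ncard hsub ((supp_finite _ _).union ((supp_finite _ _).image _))
    _ ≤ (supp n (b i)).ncard + (h⁻¹.act '' supp n (a i)).ncard := Set.ncard_union_le _ _
    _ ≤ C + C := Nat.add_le_add (hb i n)
        ((Set.ncard_image_le (supp_finite _ _)).trans (ha i n))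
    _ = 2 * C := by ring

/-- A conjugator can be replaced by one which is not more active and has few different states on
every level. -/
theorem exists_conj_levelStates [Fintype ι] (H : ∀ i, h * b i = a i * h) {C : ℕ}
    (ha : ∀ i n, (supp n (a i)).ncard ≤ C) (hb : ∀ i n, (supp n (b i)).ncard ≤ C) :
    ∃ h' : TreeAut d, (∀ i, h' * b i = a i * h') ∧
      (∀ n, (supp n h').ncard ≤ (supp n h).ncard) ∧
      ∀ n, (levelStates n h').ncard ≤ 4 * Fintype.card ι * C + 1 := by
  refine ⟨trim a b h, trim_conj H, fun n => ?_, fun n => ?_⟩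
  · exact Set.ncard_le_ncard (fun v hv => ⟨hv.1, fun h1 => hv.2 (trim_state_of_state h1)⟩)
      (supp_finite _ _)
  · have hfin : ∀ i, {v | v.length = n ∧ Exceptional a b h i v}.Finite := fun i =>
      finite_of_length fun _ h => h.1
    refine (Set.ncard_le_ncard (levelStates_trim H n) (Set.Finite.insert _
      (Set.finite_iUnion fun i => ((hfin i).image _).union ((hfin i).image _)))).trans ?_
    refine (Set.ncard_insert_le _ _).trans (Nat.add_le_add_right ?_ 1)
    calc _ ≤ ∑ i : ι, _ := by
          simpa using Set.ncard_iUnion_le_of_fintype _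
      -- Each index has at most `2 * C` exceptional vertices on the level, and each of them accounts
      -- for two states: its own and that at its image under `b i`.
      _ ≤ ∑ i : ι, 4 * C := Finset.sum_le_sum fun i _ => by
          refine (Set.ncard_union_le _ _).trans ?_
          have h1 := ncard_exceptional_le (h := h) ha hb i n
          have h2 := Set.ncard_image_le (f := (trim a b h).state) (hfin i)
          have h3 := Set.ncard_image_le (f := fun v => (trim a b h).state ((b i).act v)) (hfin i)
          omega
      _ = 4 * Fintype.card ι * C := by
          rw [Finset.sum_const, Finset.card_univ, smul_eq_mul]; ring

end Conjugator

end TreeAut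

/-! ### Short chains in finite relations -/

theorem exists_short_chain {V : Type*} [Finite V] {r : V → V → Prop} {x y : V}
    (h : Relation.ReflTransGen r x y) :
    ∃ l ≤ Nat.card V, ∃ s : ℕ → V, s 0 = x ∧ s l = y ∧ ∀ i < l, r (s i) (s (i + 1)) := by
  classical
  have hex : ∃ l, ∃ s : ℕ → V, s 0 = x ∧ s l = y ∧ ∀ i < l, r (s i) (s (i + 1)) := by
    induction h with
    | refl => exact ⟨0, fun _ => x, rfl, rfl, fun i hi => absurd hi i.not_lt_zero⟩
    | @tail b c _ hbc ih =>
      obtain ⟨l, s, h0, hl, hs⟩ := ih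
      refine ⟨l + 1, fun i => if i ≤ l then s i else c, by simp [h0], by simp, fun i hi => ?_⟩
      rcases Nat.lt_succ_iff_lt_or_eq.1 hi with h1 | rfl
      · simpa [h1.le, Nat.succ_le_of_lt h1] using hs i h1
      · simpa [hl] using hbc
  obtain ⟨s, h0, hl, hs⟩ := Nat.find_spec hex
  refine ⟨Nat.find hex, ?_, s, h0, hl, hs⟩
  by_contra! hlt
  have : Fintype V := Fintype.ofFinite V
  obtain ⟨i, hi, j, hj, hne, heq⟩ := Finset.exists_ne_map_eq_of_card_lt_of_maps_to
    (s := Finset.range (Nat.find hex)) (t := Finset.univ) (f := s)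
    (by rwa [Finset.card_range, Finset.card_univ, ← Nat.card_eq_fintype_card])
    (fun _ _ => Finset.mem_coe.2 (Finset.mem_univ _))
  wlog hij : i < j generalizing i j
  · exact this j hj i hi hne.symm heq.symm (lt_of_le_of_ne (not_lt.1 hij) hne.symm)
  rw [Finset.mem_range] at hi hj
  -- A chain of minimal length has no repetition `s i = s j`: the segment between the two positions
  -- could be cut out.
  refine Nat.find_min hex (m := Nat.find hex - (j - i)) (by omega)
    ⟨fun k => if k ≤ i then s k else s (k + (j - i)), by simp [h0], ?_, fun k hk => ?_⟩
  · change (if _ then _ else _) = _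
    rw [if_neg (by omega), Nat.sub_add_cancel (by omega), hl]
  · rcases lt_trichotomy k i with h1 | rfl | h1
    · simpa [h1.le, Nat.succ_le_of_lt h1] using hs k (h1.trans hi)
    · have := hs j hj
      rw [← heq] at this
      simpa [show k + 1 + (j - k) = j + 1 by omega] using this
    · have := hs (k + (j - i)) (by omega)
      simpa [not_le.2 h1, show ¬ k + 1 ≤ i by omega,
        show k + 1 + (j - i) = k + (j - i) + 1 by omega] using this

namespace TreeAut

variable {d : ℕ}

/-! ### Systems of equations and the automaton on a lasso -/

section Lasso

variable {S : Set (TreeAut d)} (hS : ∀ g ∈ S, ∀ x, g.state [x] ∈ S) {R : ℕ}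

/-- The state of an element of a self-similar set. -/
def stateIn (g : S) (x : Fin d) : S := ⟨(g : TreeAut d).state [x], hS g g.2 x⟩

/-- A finite system of equations `h l * β = α * h j` between unknown automorphisms which are
indexed by `Fin (R + 1)`; the unknown with index `0` stands for the trivial automorphism. -/
abbrev EqSystem (S : Set (TreeAut d)) (R : ℕ) : Type := Set (Fin (R + 1) × S × S × Fin (R + 1))

/-- The system `E'` contains the equations between the states of the first level of the unknowns
of the system `E`, if the unknowns act on the first level by `π`, and `c` describes which of the
unknowns of `E'` are their states. -/
structure IsStep (E E' : EqSystem S R) (π : Fin (R + 1) → Equiv.Perm (Fin d))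
    (c : Fin (R + 1) → Fin d → Fin (R + 1)) : Prop where
  perm_zero : π 0 = 1
  child_zero : ∀ x, c 0 x = 0
  perm : ∀ l β α j, (l, β, α, j) ∈ E → ∀ x,
    π l ((β : TreeAut d).rootPerm x) = (α : TreeAut d).rootPerm (π j x)
  child : ∀ l β α j, (l, β, α, j) ∈ E → ∀ x,
    (c l ((β : TreeAut d).rootPerm x), stateIn hS β x, stateIn hS α (π j x), c j x) ∈ E'

/-- The transition `c` keeps the number of vertices of the classes in `J` from growing, and maps
the classes in `F` to classes in `F'` or to the trivial class. -/
structure IsTame (J J' F F' : Set (Fin (R + 1))) (c : Fin (R + 1) → Fin d → Fin (R + 1)) :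
    Prop where
  unique : ∀ j ∈ J, ∀ x x', c j x ∈ J' → c j x' ∈ J' → x = x'
  not_mem : ∀ j ∉ J, ∀ x, c j x ∉ J'
  dying : ∀ j ∈ F, ∀ x, c j x = 0 ∨ c j x ∈ F'

variable {hS}

section Machine

variable {e : ℕ → EqSystem S R} {J F : ℕ → Set (Fin (R + 1))}
  {π : ℕ → Fin (R + 1) → Equiv.Perm (Fin d)} {c : ℕ → Fin (R + 1) → Fin d → Fin (R + 1)}
  {p l : ℕ}

/-- The successor of a position on the lasso with positions `0, …, l - 1` whose end is connected
to the position `p`. -/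
def lassoNext (p l k : ℕ) : ℕ := if k + 1 = l then p else k + 1

/-- The transition function of the automaton on a lasso. -/
def lassoStep (p l : ℕ) (c : ℕ → Fin (R + 1) → Fin d → Fin (R + 1)) (q : ℕ × Fin (R + 1))
    (x : Fin d) : ℕ × Fin (R + 1) :=
  (lassoNext p l q.1, c q.1 q.2 x)

/-- The tree automorphism of the automaton on a lasso. -/
def lasso (p l : ℕ) (π : ℕ → Fin (R + 1) → Equiv.Perm (Fin d))
    (c : ℕ → Fin (R + 1) → Fin d → Fin (R + 1)) (q : ℕ × Fin (R + 1)) : TreeAut d :=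
  machine (fun q : ℕ × Fin (R + 1) => π q.1 q.2) (lassoStep p l c) q

theorem lassoNext_lt (hp : p < l) {k : ℕ} (hk : k < l) : lassoNext p l k < l := by
  unfold lassoNext
  split_ifs <;> omega

theorem lassoNext_congr {α : Type*} {f : ℕ → α} (hf : f l = f p) (k : ℕ) :
    f (lassoNext p l k) = f (k + 1) := by
  unfold lassoNext
  split_ifs with h
  · rw [h, hf]
  · rfl

theorem foldl_lassoStep_fst (q : ℕ × Fin (R + 1)) (v : List (Fin d)) :
    (v.foldl (lassoStep p l c) q).1 = (lassoNext p l)^[v.length] q.1 := by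
  induction v generalizing q with
  | nil => rfl
  | cons x v ih => rw [List.foldl_cons, ih, List.length_cons, Function.iterate_succ_apply]; rfl

theorem iterate_lassoNext_lt (hp : p < l) {k : ℕ} (hk : k < l) (n : ℕ) :
    (lassoNext p l)^[n] k < l := by
  induction n with
  | zero => exact hk
  | succ n ih => rw [Function.iterate_succ_apply']; exact lassoNext_lt hp ih

theorem iterate_lassoNext {k i : ℕ} (hi : k + i < l) : (lassoNext p l)^[i] k = k + i := by
  induction i with
  | zero => rfl
  | succ i ih =>
    rw [Function.iterate_succ_apply', ih (by omega), lassoNext, if_neg (by omega), add_assoc]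

theorem iterate_lassoNext_loop (hp : p < l) : (lassoNext p l)^[l - p] p = p := by
  obtain ⟨i, rfl⟩ : ∃ i, l = p + i + 1 := ⟨l - p - 1, by omega⟩
  rw [show p + i + 1 - p = i + 1 by omega, Function.iterate_succ_apply',
    iterate_lassoNext (by omega), lassoNext, if_pos rfl]

theorem iterate_lassoNext_mul (hp : p < l) (t : ℕ) :
    (lassoNext p l)^[p + t * (l - p)] 0 = p := by
  induction t with
  | zero => rw [Nat.zero_mul, add_zero, iterate_lassoNext (by omega), zero_add]
  | succ t ih =>
    rw [show p + (t + 1) * (l - p) = (l - p) + (p + t * (l - p)) by ring,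
      Function.iterate_add_apply, ih, iterate_lassoNext_loop hp]

theorem lasso_state (q : ℕ × Fin (R + 1)) (v : List (Fin d)) :
    (lasso p l π c q).state v = lasso p l π c (v.foldl (lassoStep p l c) q) :=
  machine_state _ _ _ _

theorem foldl_lassoStep_zero (hp : p < l)
    (hstep : ∀ k < l, IsStep hS (e k) (e (k + 1)) (π k) (c k)) {k : ℕ} (hk : k < l)
    (v : List (Fin d)) : (v.foldl (lassoStep p l c) (k, 0)).2 = 0 := by
  induction v generalizing k with
  | nil => rfl
  | cons x v ih =>
    rw [List.foldl_cons, lassoStep, (hstep k hk).child_zero]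
    exact ih (lassoNext_lt hp hk)

theorem lasso_zero (hp : p < l)
    (hstep : ∀ k < l, IsStep hS (e k) (e (k + 1)) (π k) (c k)) {k : ℕ} (hk : k < l) :
    lasso p l π c (k, 0) = 1 := by
  refine machine_eq_one _ _ fun v => ?_
  rw [foldl_lassoStep_zero hp hstep hk, foldl_lassoStep_fst]
  exact (hstep _ (iterate_lassoNext_lt hp hk _)).perm_zero

/-- The two sides of all equations along the lasso form a bisimulation: `IsStep` matches the root
permutations and sends an equation to equations of the next system, and `e l = e p` closes the loop.
-/
theorem lasso_mul (hp : p < l)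
    (hstep : ∀ k < l, IsStep hS (e k) (e (k + 1)) (π k) (c k)) (he : e l = e p)
    {k : ℕ} (hk : k < l) {i j : Fin (R + 1)} {β α : S} (hE : (i, β, α, j) ∈ e k) :
    lasso p l π c (k, i) * (β : TreeAut d) = (α : TreeAut d) * lasso p l π c (k, j) := by
  refine eq_of_bisim (fun g g' => ∃ k < l, ∃ i β α j, (i, β, α, j) ∈ e k ∧
    g = lasso p l π c (k, i) * (β : TreeAut d) ∧ g' = (α : TreeAut d) * lasso p l π c (k, j))
    ?_ ?_ ⟨k, hk, i, β, α, j, hE, rfl, rfl⟩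
  · rintro _ _ ⟨k, hk, i, β, α, j, hE, rfl, rfl⟩ x
    rw [rootPerm_mul, rootPerm_mul, lasso, lasso, machine_rootPerm, machine_rootPerm]
    exact (hstep k hk).perm _ _ _ _ hE x
  · rintro _ _ ⟨k, hk, i, β, α, j, hE, rfl, rfl⟩ x
    refine ⟨lassoNext p l k, lassoNext_lt hp hk, c k i ((β : TreeAut d).rootPerm x),
      stateIn hS β x, stateIn hS α (π k j x), c k j x, ?_, ?_, ?_⟩
    · rw [lassoNext_congr he]
      exact (hstep k hk).child _ _ _ _ hE x
    · rw [mul_state_letter, lasso_state]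
      rfl
    · rw [mul_state_letter, lasso_state, lasso, machine_rootPerm]
      rfl

theorem range_lasso_state_subset (hp : p < l) (j : Fin (R + 1)) :
    Set.range (lasso p l π c (0, j)).state ⊆
      (lasso p l π c '' ((Finset.range l ×ˢ Finset.univ : Finset (ℕ × Fin (R + 1))) : Set _)) := by
  rintro _ ⟨v, rfl⟩
  refine ⟨_, ?_, (lasso_state _ _).symm⟩
  rw [Finset.mem_coe, Finset.mem_product, Finset.mem_range, foldl_lassoStep_fst]
  exact ⟨iterate_lassoNext_lt hp (by omega) _, Finset.mem_univ _⟩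

theorem ncard_range_lasso_state_le (hp : p < l) (j : Fin (R + 1)) :
    (Set.range (lasso p l π c (0, j)).state).ncard ≤ l * (R + 1) := by
  refine (Set.ncard_le_ncard (range_lasso_state_subset hp j)
    ((Finset.finite_toSet _).image _)).trans ?_
  refine (Set.ncard_image_le (Finset.finite_toSet _)).trans ?_
  rw [Set.ncard_coe_finset, Finset.card_product, Finset.card_range, Finset.card_univ,
    Fintype.card_fin]

/-- A class outside `J` at the start of the loop stays in the sets `F` or becomes trivial. When `F
l` is empty, it is trivial after one full turn. -/
theorem foldl_lassoStep_dying
    (hstep : ∀ k < l, IsStep hS (e k) (e (k + 1)) (π k) (c k))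
    (htame : ∀ k, p ≤ k → k < l → IsTame (J k) (J (k + 1)) (F k) (F (k + 1)) (c k))
    (hF : ∀ j ∉ J p, j = 0 ∨ j ∈ F p) {j : Fin (R + 1)} (hj : j ∉ J p) {w : List (Fin d)}
    (hw : p + w.length ≤ l) : (w.foldl (lassoStep p l c) (p, j)).2 = 0 ∨
      (w.foldl (lassoStep p l c) (p, j)).2 ∈ F (p + w.length) := by
  induction w using List.reverseRecOn with
  | nil => exact hF j hj
  | append_singleton w x ih =>
    rw [List.length_append, List.length_singleton] at hw
    have hpos : (w.foldl (lassoStep p l c) (p, j)).1 = p + w.length := by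
      rw [foldl_lassoStep_fst, iterate_lassoNext (by omega)]
    rw [List.foldl_append, List.foldl_cons, List.foldl_nil, lassoStep, hpos,
      List.length_append, List.length_singleton, ← add_assoc]
    rcases ih (by omega) with h | h
    · left
      simp only [h, (hstep _ (show p + w.length < l by omega)).child_zero]
    · exact (htame _ (Nat.le_add_right _ _) (by omega)).dying _ h x

/-- The set of vertices of level `n` at which the automaton on a lasso is in a class in `J`. -/
def lassoSet (p l : ℕ) (c : ℕ → Fin (R + 1) → Fin d → Fin (R + 1))
    (J : ℕ → Set (Fin (R + 1))) (j : Fin (R + 1)) (n : ℕ) : Set (List (Fin d)) :=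
  {v | v.length = n ∧
    (v.foldl (lassoStep p l c) (0, j)).2 ∈ J (v.foldl (lassoStep p l c) (0, j)).1}

/-- From position `p` on, a class in `J` has at most one child in `J` and a class outside has none,
so deleting the last letter is injective on these vertices. -/
theorem ncard_lassoSet_le (hp : p < l)
    (htame : ∀ k, p ≤ k → k < l → IsTame (J k) (J (k + 1)) (F k) (F (k + 1)) (c k))
    (hJ : J l = J p) (j : Fin (R + 1)) {n : ℕ} (hn : p ≤ n) :
    (lassoSet p l c J j n).ncard ≤ (lassoSet p l c J j p).ncard := by
  have hpos : ∀ n, p ≤ n → p ≤ (lassoNext p l)^[n] 0 := fun n hn => by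
    induction n, hn using Nat.le_induction with
    | base => rw [iterate_lassoNext (by omega)]; omega
    | succ n _ ih =>
      rw [Function.iterate_succ_apply', lassoNext]
      split_ifs <;> omega
  induction n, hn using Nat.le_induction with
  | base => exact le_rfl
  | succ n hn ih =>
    refine le_trans (Set.ncard_le_ncard_of_injOn (List.take n) ?_ ?_
      (finite_of_length fun v hv => hv.1)) ih
    · rintro v ⟨hv, hm⟩
      obtain rfl | ⟨v, x, rfl⟩ := v.eq_nil_or_concat'
      · simp at hv
      have hv' : v.length = n := by simpa using hv
      rw [← hv', List.take_left]
      refine ⟨rfl, ?_⟩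
      by_contra hnot
      rw [List.foldl_append, List.foldl_cons, List.foldl_nil, lassoStep,
        lassoNext_congr hJ] at hm
      refine (htame _ ?_ ?_).not_mem _ hnot x hm
      · rw [foldl_lassoStep_fst]; exact hpos _ (hv' ▸ hn)
      · rw [foldl_lassoStep_fst]; exact iterate_lassoNext_lt hp (by omega) _
    · rintro v ⟨hv, hm⟩ v' ⟨hv', hm'⟩ heq
      obtain rfl | ⟨v, x, rfl⟩ := v.eq_nil_or_concat'
      · simp at hv
      obtain rfl | ⟨v', x', rfl⟩ := v'.eq_nil_or_concat'
      · simp at hv'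
      have h1 : v.length = n := by simpa using hv
      have h2 : v'.length = n := by simpa using hv'
      replace heq : v = v' := by
        rwa [← h1, List.take_left, h1, ← h2, List.take_left] at heq
      subst heq
      rw [List.foldl_append, List.foldl_cons, List.foldl_nil, lassoStep,
        lassoNext_congr hJ] at hm hm'
      have htm := htame (v.foldl (lassoStep p l c) (0, j)).1
        (by rw [foldl_lassoStep_fst]; exact hpos _ (h1 ▸ hn))
        (by rw [foldl_lassoStep_fst]; exact iterate_lassoNext_lt hp (by omega) _)
      rw [htm.unique _ (by_contra fun hnot => htm.not_mem _ hnot x hm) x x' hm hm']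

theorem lasso_isBounded (hp : p < l)
    (hstep : ∀ k < l, IsStep hS (e k) (e (k + 1)) (π k) (c k))
    (htame : ∀ k, p ≤ k → k < l → IsTame (J k) (J (k + 1)) (F k) (F (k + 1)) (c k))
    (hJ : J l = J p) (hF : ∀ j ∉ J p, j = 0 ∨ j ∈ F p) (hFl : F l = ∅) (j : Fin (R + 1)) :
    (lasso p l π c (0, j)).IsBounded := by
  refine isBounded_of_supp (C := (d + 1) ^ (2 * l) +
    (lassoSet p l c J j p).ncard * (d + 1) ^ (2 * l)) (((Finset.finite_toSet _).image _).subset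
      (range_lasso_state_subset hp j)) fun n => ?_
  rcases lt_or_ge n l with hn | hn
  · exact (ncard_length_le (by omega) fun v hv => hv.1).trans (Nat.le_add_right _ _)
  -- The cut is made at a start of the loop, at least one full turn and less than two turns above
  -- level `n`. If the class at the cut is outside `J`, it is trivial before level `n` is passed; so
  -- a non-trivial state needs a class in `J` at the cut.
  obtain ⟨t, r, hr, hn⟩ : ∃ t r, r < l - p ∧ n = (p + t * (l - p)) + ((l - p) + r) := by
    refine ⟨(n - l) / (l - p), (n - l) % (l - p), Nat.mod_lt _ (by omega), ?_⟩
    have := Nat.div_add_mod' (n - l) (l - p)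
    omega
  have hsub : supp n (lasso p l π c (0, j)) ⊆ (fun q : List (Fin d) × List (Fin d) => q.1 ++ q.2) ''
      (lassoSet p l c J j (p + t * (l - p)) ×ˢ {v : List (Fin d) | v.length = (l - p) + r}) := by
    rintro v ⟨hv, hne⟩
    refine ⟨(v.take (p + t * (l - p)), v.drop (p + t * (l - p))), ⟨⟨?_, ?_⟩, ?_⟩, by simp⟩
    · rw [List.length_take]; omega
    · by_contra hnot
      set u := v.take (p + t * (l - p)) with hu
      have hul : u.length = p + t * (l - p) := by rw [hu, List.length_take]; omega
      set w := (v.drop (p + t * (l - p))).take (l - p) with hw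
      have hwl : w.length = l - p := by rw [hw, List.length_take, List.length_drop]; omega
      have hpos : (u.foldl (lassoStep p l c) (0, j)).1 = p := by
        rw [foldl_lassoStep_fst, hul, iterate_lassoNext_mul hp]
      have hpre : u ++ w <+: v := by
        conv_rhs => rw [← List.take_append_drop (p + t * (l - p)) v]
        exact (List.prefix_append_right_inj _).2 (List.take_prefix _ _)
      refine hne (state_eq_one_of_prefix ?_ hpre)
      rw [lasso_state, List.foldl_append]
      have hq : u.foldl (lassoStep p l c) (0, j) =
          (p, (u.foldl (lassoStep p l c) (0, j)).2) := Prod.ext hpos rfl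
      rw [hpos] at hnot
      have hdie := foldl_lassoStep_dying hstep htame hF hnot (w := w) (by omega)
      rw [hwl, show p + (l - p) = l by omega, hFl, Set.mem_empty_iff_false, or_false, ← hq] at hdie
      rw [show w.foldl (lassoStep p l c) (u.foldl (lassoStep p l c) (0, j)) =
        ((w.foldl (lassoStep p l c) (u.foldl (lassoStep p l c) (0, j))).1, 0) from
        Prod.ext rfl hdie]
      refine lasso_zero hp hstep ?_
      rw [foldl_lassoStep_fst, hpos]
      exact iterate_lassoNext_lt hp hp _
    · change (v.drop _).length = _
      rw [List.length_drop]; omega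
  have hfin : (lassoSet p l c J j (p + t * (l - p)) ×ˢ
      {v : List (Fin d) | v.length = (l - p) + r}).Finite :=
    (finite_of_length fun v hv => hv.1).prod (finite_of_length fun _ h => h)
  calc _ ≤ _ := Set.ncard_le_ncard hsub (hfin.image _)
    _ ≤ _ := Set.ncard_image_le hfin
    _ = (lassoSet p l c J j (p + t * (l - p))).ncard *
        {v : List (Fin d) | v.length = (l - p) + r}.ncard := Set.ncard_prod
    _ ≤ (lassoSet p l c J j p).ncard * (d + 1) ^ (2 * l) :=
        Nat.mul_le_mul (ncard_lassoSet_le hp htame hJ j (Nat.le_add_right _ _))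
          (ncard_length_le (n := l - p + r) (by omega) fun _ h => h)
    _ ≤ _ := Nat.le_add_left _ _

end Machine

end Lasso

/-! ### Immortal vertices of a bounded automorphism, and numberings of its states -/

theorem ncard_immortalSet_lt_succ {g : TreeAut d} {n : ℕ} {v : List (Fin d)} (hv : v.length = n)
    {x x' : Fin d} (hne : x ≠ x') (hx : (g.state (v ++ [x])).Immortal)
    (hx' : (g.state (v ++ [x'])).Immortal) :
    (immortalSet n g).ncard < (immortalSet (n + 1) g).ncard := by
  have : Nonempty (Fin d) := ⟨x⟩
  choose! f hf using fun (h : TreeAut d) (hh : h.Immortal) => hh.exists_letter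
  obtain ⟨y, hy, hvy⟩ : ∃ y, y ≠ f (g.state v) ∧ (g.state (v ++ [y])).Immortal := by
    by_cases h : x = f (g.state v)
    · exact ⟨x', fun h' => hne (h.trans h'.symm), hx'⟩
    · exact ⟨x, h, hx⟩
  have hinj : Function.Injective fun v => v ++ [f (g.state v)] := fun _ _ h =>
    (List.append_inj' h rfl).1
  have hsub : insert (v ++ [y]) ((fun v => v ++ [f (g.state v)]) '' immortalSet n g) ⊆
      immortalSet (n + 1) g := by
    rintro _ (rfl | ⟨w, hw, rfl⟩)
    · exact ⟨by simp [hv], hvy⟩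
    · exact ⟨by simp [hw.1], by rw [state_append]; exact hf _ hw.2⟩
  have h1 := Set.ncard_le_ncard hsub (immortalSet_finite _ _)
  have hnot : v ++ [y] ∉ (fun v => v ++ [f (g.state v)]) '' immortalSet n g := by
    rintro ⟨w, -, hw⟩
    obtain ⟨rfl, h2⟩ := List.append_inj' hw rfl
    exact hy (List.singleton_inj.1 h2).symm
  rwa [Set.ncard_insert_of_notMem hnot ((immortalSet_finite _ _).image _),
    Set.ncard_image_of_injective _ hinj] at h1

theorem ncard_immortalSet_le_succ (g : TreeAut d) (n : ℕ) :
    (immortalSet n g).ncard ≤ (immortalSet (n + 1) g).ncard := by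
  rcases (immortalSet n g).eq_empty_or_nonempty with h0 | ⟨v, hv⟩
  · rw [h0, Set.ncard_empty]
    exact Nat.zero_le _
  have : Nonempty (Fin d) := hv.2.exists_letter.nonempty
  choose! f hf using fun (h : TreeAut d) (hh : h.Immortal) => hh.exists_letter
  exact Set.ncard_le_ncard_of_injOn (fun v => v ++ [f (g.state v)])
    (fun w hw => ⟨by simp [hw.1], by rw [state_append]; exact hf _ hw.2⟩)
    (fun _ _ _ _ h => (List.append_inj' h rfl).1) (immortalSet_finite _ _)

/-- The number of immortal vertices is monotone and bounded in the level, so it is eventually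
constant; any further branching would increase it. -/
theorem exists_immortal_unique {g : TreeAut d} {C : ℕ} (hC : ∀ n, (supp n g).ncard ≤ C) :
    ∃ n₀, ∀ v : List (Fin d), n₀ ≤ v.length → ∀ x x', (g.state (v ++ [x])).Immortal →
      (g.state (v ++ [x'])).Immortal → x = x' := by
  have hmono : Monotone fun n => (immortalSet n g).ncard :=
    monotone_nat_of_le_succ (ncard_immortalSet_le_succ g)
  have hbdd : BddAbove (Set.range fun n => (immortalSet n g).ncard) :=
    ⟨C, by
      rintro _ ⟨n, rfl⟩
      exact (Set.ncard_le_ncard (immortalSet_subset_supp n g) (supp_finite n g)).trans (hC n)⟩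
  obtain ⟨n₀, hn₀⟩ := Nat.sSup_mem (Set.range_nonempty _) hbdd
  refine ⟨n₀, fun v hv x x' hx hx' => by_contra fun hne => ?_⟩
  have h1 := ncard_immortalSet_lt_succ rfl hne hx hx'
  have h2 := hmono hv
  have h3 := le_csSup hbdd ⟨v.length + 1, rfl⟩
  simp only at hn₀ h2 h3
  omega

theorem levelStates_finite (n : ℕ) (g : TreeAut d) : (levelStates n g).Finite :=
  ((List.finite_length_eq (Fin d) n).image _).insert _

theorem exists_injOn_fin {s : Set (TreeAut d)} (hs : s.Finite) {R : ℕ} (hR : s.ncard ≤ R + 1) :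
    ∃ ν : TreeAut d → Fin (R + 1), ν 1 = 0 ∧ Set.InjOn ν s := by
  obtain ⟨f, -, hf⟩ := hs.exists_injOn_of_encard_le
    (t := (Set.univ : Set (Fin (R + 1)))) (by
      rw [← hs.cast_ncard_eq, Set.encard_univ, ENat.card_eq_coe_fintype_card, Fintype.card_fin]
      exact_mod_cast hR)
  -- The swap reserves the number `0` for the trivial automorphism, as the systems of equations
  -- require.
  exact ⟨fun x => Equiv.swap (f 1) 0 (f x), Equiv.swap_apply_left _ _,
    fun x hx y hy h => hf hx hy ((Equiv.swap (f 1) 0).injective h)⟩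

theorem exists_numbering {g : TreeAut d} {R : ℕ} (hR : ∀ n, (levelStates n g).ncard ≤ R + 1) :
    ∃ ν : ℕ → TreeAut d → Fin (R + 1), (∀ n, ν n 1 = 0) ∧
      ∀ n, Set.InjOn (ν n) (levelStates n g) := by
  choose ν h1 h2 using fun n => exists_injOn_fin (levelStates_finite n g) (hR n)
  exact ⟨ν, h1, h2⟩

/-! ### Classes of states on a level, immortal and mortal -/

section ClassRep

variable {R : ℕ} (ν : ℕ → TreeAut d → Fin (R + 1)) (h : TreeAut d)

/-- The state of `h` on the level `n` with number `j`, or the trivial automorphism if there is no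
such state. -/
noncomputable def classRep (n : ℕ) (j : Fin (R + 1)) : TreeAut d :=
  open Classical in
  if H : ∃ g ∈ levelStates n h, ν n g = j then H.choose else 1

/-- The number of the state of the `j`-th state of `h` on the level `n` at the letter `x`. -/
noncomputable def classChild (n : ℕ) (j : Fin (R + 1)) (x : Fin d) : Fin (R + 1) :=
  ν (n + 1) ((classRep ν h n j).state [x])

/-- The numbers of the immortal states of `h` on the level `n`. -/
def immortalClasses (n : ℕ) : Set (Fin (R + 1)) := {j | (classRep ν h n j).Immortal}

/-- The numbers of the non-trivial states on the level `p + t` which descend from mortal classes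
of the level `p`. -/
def mortalClasses (p : ℕ) : ℕ → Set (Fin (R + 1))
  | 0 => {j | j ≠ 0 ∧ j ∉ immortalClasses ν h p}
  | t + 1 => {j | j ≠ 0 ∧ ∃ i ∈ mortalClasses p t, ∃ x, j = classChild ν h (p + t) i x}

variable {ν h}

theorem one_mem_levelStates (n : ℕ) : 1 ∈ levelStates n h := Set.mem_insert _ _

theorem state_mem_levelStates {n : ℕ} {v : List (Fin d)} (hv : v.length = n) :
    h.state v ∈ levelStates n h := Or.inr ⟨v, hv, rfl⟩

theorem state_letter_mem_levelStates {n : ℕ} {g : TreeAut d} (hg : g ∈ levelStates n h)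
    (x : Fin d) : g.state [x] ∈ levelStates (n + 1) h := by
  obtain rfl | ⟨v, hv, rfl⟩ := hg
  · rw [state_one]
    exact one_mem_levelStates _
  · rw [← state_append]
    refine state_mem_levelStates ?_
    rw [List.length_append, List.length_singleton, show v.length = n from hv]

theorem classRep_mem (n : ℕ) (j : Fin (R + 1)) : classRep ν h n j ∈ levelStates n h := by
  unfold classRep
  split_ifs with H
  · exact H.choose_spec.1
  · exact one_mem_levelStates n



theorem classRep_number (hν : ∀ n, Set.InjOn (ν n) (levelStates n h)) {n : ℕ} {g : TreeAut d} (hg : g ∈ levelStates n h) :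
    classRep ν h n (ν n g) = g := by
  have H : ∃ g' ∈ levelStates n h, ν n g' = ν n g := ⟨g, hg, rfl⟩
  rw [classRep, dif_pos H]
  exact hν n H.choose_spec.1 hg H.choose_spec.2

theorem classRep_classChild (hν : ∀ n, Set.InjOn (ν n) (levelStates n h)) (n : ℕ)
    (j : Fin (R + 1)) (x : Fin d) :
    classRep ν h (n + 1) (classChild ν h n j x) = (classRep ν h n j).state [x] :=
  classRep_number hν (state_letter_mem_levelStates (classRep_mem n j) x)

theorem classRep_zero (h1 : ∀ n, ν n 1 = 0) (hν : ∀ n, Set.InjOn (ν n) (levelStates n h))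
    (n : ℕ) : classRep ν h n 0 = 1 := by
  rw [← h1 n]
  exact classRep_number hν (one_mem_levelStates n)

theorem mortalClasses_descend (hν : ∀ n, Set.InjOn (ν n) (levelStates n h)) {p t : ℕ}
    {j : Fin (R + 1)} (hj : j ∈ mortalClasses ν h p t) :
    ∃ i, ¬ (classRep ν h p i).Immortal ∧ ∃ w : List (Fin d), w.length = t ∧
      classRep ν h (p + t) j = (classRep ν h p i).state w := by
  induction t generalizing j with
  | zero => exact ⟨j, hj.2, [], rfl, (state_nil _).symm⟩
  | succ t ih =>
    obtain ⟨-, i, hi, x, rfl⟩ := hj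
    obtain ⟨i', hi', w, hw, e⟩ := ih hi
    refine ⟨i', hi', w ++ [x], by simp [hw], ?_⟩
    rw [← add_assoc, classRep_classChild hν, e, state_append]

/-- There are finitely many mortal classes on level `p`, each with its own time of death, and all
classes counted later descend from them. -/
theorem exists_mortalClasses_eq_empty (h1 : ∀ n, ν n 1 = 0)
    (hν : ∀ n, Set.InjOn (ν n) (levelStates n h)) (p : ℕ) :
    ∃ K, ∀ t, K ≤ t → mortalClasses ν h p t = ∅ := by
  have key : ∀ i : Fin (R + 1), ∃ k, ¬ (classRep ν h p i).Immortal →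
      ∀ w : List (Fin d), w.length = k → (classRep ν h p i).state w = 1 := by
    intro i
    by_cases hi : (classRep ν h p i).Immortal
    · exact ⟨0, fun h => absurd hi h⟩
    · have := hi
      simp only [Immortal, not_forall, not_exists, not_and, not_not] at this
      exact this.imp fun k hk _ => hk
  choose k hk using key
  refine ⟨Finset.univ.sup k + 1, fun t ht => Set.eq_empty_of_forall_notMem fun j hj => ?_⟩
  obtain ⟨t, rfl⟩ : ∃ t', t = t' + 1 := ⟨t - 1, by omega⟩
  obtain ⟨hj0, i, hi, x, rfl⟩ := hj
  obtain ⟨i', hi', w, hw, e⟩ := mortalClasses_descend hν hi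
  refine hj0 ?_
  have := Finset.le_sup (f := k) (Finset.mem_univ i')
  rw [classChild, e, state_eq_one_of_level (hk i' hi') (by omega), state_one, h1]

/-- Below level `n₀` immortal branches do not split, which gives uniqueness; a mortal state has no
immortal child; the sets of mortal classes are closed under non-trivial children by construction. -/
theorem isTame_classChild (hν : ∀ n, Set.InjOn (ν n) (levelStates n h)) {n₀ p t : ℕ}
    (hu : ∀ v : List (Fin d), n₀ ≤ v.length → ∀ x x', (h.state (v ++ [x])).Immortal →
      (h.state (v ++ [x'])).Immortal → x = x') (hp : n₀ ≤ p) :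
    IsTame (immortalClasses ν h (p + t)) (immortalClasses ν h (p + t + 1))
      (mortalClasses ν h p t) (mortalClasses ν h p (t + 1)) (classChild ν h (p + t)) where
  unique := fun j hj x x' hx hx' => by
    change (classRep _ _ _ _).Immortal at hj hx hx'
    rw [classRep_classChild hν] at hx hx'
    obtain hr | ⟨v, hv, hr⟩ := classRep_mem (ν := ν) (h := h) (p + t) j
    · exact absurd hr hj.ne_one
    · rw [← hr, ← state_append] at hx hx'
      exact hu v (by rw [show v.length = p + t from hv]; omega) x x' hx hx'
  not_mem := fun j hj x hx => by
    change (classRep _ _ _ _).Immortal at hx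
    rw [classRep_classChild hν] at hx
    exact hj hx.of_state
  dying := fun j hj x => by
    by_cases h0 : classChild ν h (p + t) j x = 0
    · exact Or.inl h0
    · exact Or.inr ⟨h0, j, hj, x, rfl⟩

end ClassRep

/-! ### From an arbitrary bounded conjugator to a lasso of bounded size -/

section LevelSystem

variable {ι : Type*} {a b : ι → TreeAut d} {h : TreeAut d} {S : Set (TreeAut d)} {R : ℕ}

/-- The system of the equations between the states of `h` on the level `n`. -/
def levelSystem (a b : ι → TreeAut d) (h : TreeAut d) (S : Set (TreeAut d))
    (ν : ℕ → TreeAut d → Fin (R + 1)) (n : ℕ) : EqSystem S R :=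
  {q | ∃ i v, v.length = n ∧ q.1 = ν n (h.state ((b i).act v)) ∧
    (q.2.1 : TreeAut d) = (b i).state v ∧ (q.2.2.1 : TreeAut d) = (a i).state (h.act v) ∧
    q.2.2.2 = ν n (h.state v)}

/-- The equation at `v ++ [x]` is the state at `x` of the equation at `v`; injectivity of the
numbering on a level makes it depend only on the classes. -/
theorem isStep_levelSystem (hS : ∀ g ∈ S, ∀ x, g.state [x] ∈ S) (H : ∀ i, h * b i = a i * h)
    {ν : ℕ → TreeAut d → Fin (R + 1)} (h1 : ∀ n, ν n 1 = 0)
    (hν : ∀ n, Set.InjOn (ν n) (levelStates n h)) (n : ℕ) :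
    IsStep hS (levelSystem a b h S ν n) (levelSystem a b h S ν (n + 1))
      (fun j => (classRep ν h n j).rootPerm) (classChild ν h n) where
  perm_zero := by rw [classRep_zero h1 hν, rootPerm_one]
  child_zero := fun x => by rw [classChild, classRep_zero h1 hν, state_one, h1]
  perm := by
    rintro l β α j ⟨i, v, hv, hl, hβ, hα, hj⟩ x
    simp only at hl hβ hα hj
    rw [hl, hj, hβ, hα, classRep_number hν (state_mem_levelStates hv),
      classRep_number hν (state_mem_levelStates (by rw [length_act, hv])),
      ← rootPerm_mul, ← rootPerm_mul, conj_state H]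
  child := by
    rintro l β α j ⟨i, v, hv, hl, hβ, hα, hj⟩ x
    simp only at hl hβ hα hj
    refine ⟨i, v ++ [x], by simp [hv], ?_, ?_, ?_, ?_⟩
    · simp only [hl, classChild]
      rw [classRep_number hν (state_mem_levelStates (by rw [length_act, hv])), act_snoc,
        state_append, hβ]
    · simp only [stateIn]
      rw [hβ, state_append]
    · simp only [stateIn]
      rw [hα, hj, classRep_number hν (state_mem_levelStates hv), act_snoc, state_append]
    · simp only [classChild]
      rw [hj, classRep_number hν (state_mem_levelStates hv), state_append]

theorem reflTransGen_of_succ {V : Type*} {r : V → V → Prop} (s : ℕ → V)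
    (hs : ∀ n, r (s n) (s (n + 1))) (n : ℕ) : Relation.ReflTransGen r (s 0) (s n) := by
  induction n with
  | zero => exact .refl
  | succ n ih => exact ih.tail (hs n)

/-- Bounded conjugators can be chosen with an explicit bound on the number of states. -/
theorem exists_isBounded_conj (hfin : S.Finite) (hS : ∀ g ∈ S, ∀ x, g.state [x] ∈ S)
    (ha : ∀ i, a i ∈ S) (hb : ∀ i, b i ∈ S) (H : ∀ i, h * b i = a i * h) {C : ℕ}
    (hC : ∀ n, (supp n h).ncard ≤ C) (hR : ∀ n, (levelStates n h).ncard ≤ R + 1) :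
    ∃ h' : TreeAut d, h'.IsBounded ∧ (∀ i, h' * b i = a i * h') ∧
      (Set.range h'.state).ncard ≤ (Nat.card (EqSystem S R) +
        (Nat.card (EqSystem S R × Set (Fin (R + 1)) × Set (Fin (R + 1))) + 1)) * (R + 1) := by
  have : Finite S := hfin
  obtain ⟨ν, h1, hν⟩ := exists_numbering hR
  obtain ⟨n₀, hu⟩ := exists_immortal_unique hC
  set E := levelSystem a b h S ν with hE
  set J := immortalClasses ν h with hJ
  -- Some pair of a system and a set of immortal classes recurs infinitely often. Its occurrences
  -- `p` and `q` are chosen beyond the last branching of immortal vertices and after the death of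
  -- all classes mortal at `p`, respectively.
  obtain ⟨⟨E₀, J₀⟩, hinf⟩ := Finite.exists_infinite_fiber fun n => (E n, J n)
  rw [Set.infinite_coe_iff, Set.infinite_iff_exists_gt] at hinf
  obtain ⟨p, hp, hnp⟩ := hinf n₀
  obtain ⟨K, hK⟩ := exists_mortalClasses_eq_empty h1 hν p
  obtain ⟨q, hq, hpq⟩ := hinf (p + K)
  obtain ⟨t, rfl⟩ : ∃ t, q = p + t + 1 := ⟨q - p - 1, by omega⟩
  simp only [Set.mem_preimage, Set.mem_singleton_iff, Prod.mk.injEq] at hp hq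
  let r₁ : EqSystem S R → EqSystem S R → Prop := fun x y => ∃ π c, IsStep hS x y π c
  let r₂ : EqSystem S R × Set (Fin (R + 1)) × Set (Fin (R + 1)) →
      EqSystem S R × Set (Fin (R + 1)) × Set (Fin (R + 1)) → Prop := fun x y =>
    ∃ π c, IsStep hS x.1 y.1 π c ∧ IsTame x.2.1 y.2.1 x.2.2 y.2.2 c
  have hr₁ : ∀ n, r₁ (E n) (E (n + 1)) := fun n => ⟨_, _, isStep_levelSystem hS H h1 hν n⟩
  let N : ℕ → EqSystem S R × Set (Fin (R + 1)) × Set (Fin (R + 1)) := fun i =>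
    (E (p + i), J (p + i), mortalClasses ν h p i)
  have hr₂ : ∀ i, r₂ (N i) (N (i + 1)) := fun i =>
    ⟨_, _, isStep_levelSystem hS H h1 hν (p + i), isTame_classChild hν hu hnp.le⟩
  -- The tail only has to respect the equations. In the loop the sets of immortal and of mortal
  -- classes are part of the vertices of the chain, so that shortening preserves tameness. The first
  -- step of the loop is kept apart, so that the loop cannot shrink to length zero.
  obtain ⟨l₁, hl₁, s₁, hs₁, hs₁', hs₁r⟩ := exists_short_chain (reflTransGen_of_succ E hr₁ p)
  obtain ⟨l₂, hl₂, s₂, hs₂, hs₂', hs₂r⟩ := exists_short_chain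
    (reflTransGen_of_succ (fun i => N (i + 1)) (fun i => hr₂ (i + 1)) t)
  let s : ℕ → EqSystem S R × Set (Fin (R + 1)) × Set (Fin (R + 1)) := fun i =>
    Nat.casesOn i (N 0) s₂
  have hsr : ∀ i < l₂ + 1, r₂ (s i) (s (i + 1)) := fun i hi => by
    obtain _ | i := i
    · change r₂ (N 0) (s₂ 0)
      rw [hs₂]
      exact hr₂ 0
    · exact hs₂r i (by omega)
  let e : ℕ → EqSystem S R := fun k => if k < l₁ then s₁ k else (s (k - l₁)).1
  have hstep : ∀ k, ∃ π c, k < l₁ + (l₂ + 1) → IsStep hS (e k) (e (k + 1)) π c ∧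
      (l₁ ≤ k → IsTame (s (k - l₁)).2.1 (s (k + 1 - l₁)).2.1 (s (k - l₁)).2.2
        (s (k + 1 - l₁)).2.2 c) := by
    intro k
    rcases lt_or_ge k l₁ with hk | hk
    · obtain ⟨π, c, hπ⟩ := hs₁r k hk
      refine ⟨π, c, fun _ => ⟨?_, fun h => absurd hk (not_lt.2 h)⟩⟩
      have he : e (k + 1) = s₁ (k + 1) := by
        by_cases hk' : k + 1 < l₁
        · exact if_pos hk'
        · rw [show k + 1 = l₁ by omega, hs₁']
          simp only [e, lt_irrefl, if_false, Nat.sub_self]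
          rfl
      rw [he, show e k = s₁ k from if_pos hk]
      exact hπ
    · by_cases hk' : k < l₁ + (l₂ + 1)
      · obtain ⟨π, c, hπ⟩ := hsr (k - l₁) (by omega)
        refine ⟨π, c, fun _ => ?_⟩
        rw [show e k = (s (k - l₁)).1 from if_neg (by omega),
          show e (k + 1) = (s (k + 1 - l₁)).1 from if_neg (by omega),
          show k + 1 - l₁ = k - l₁ + 1 by omega]
        exact ⟨hπ.1, fun _ => hπ.2⟩
      · exact ⟨fun _ => 1, fun _ _ => 0, fun h => absurd h hk'⟩
  choose π c hπc using hstep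
  have hlast : s (l₂ + 1) = N (t + 1) := hs₂'
  have hel : e (l₁ + (l₂ + 1)) = e l₁ := by
    simp only [e, lt_irrefl, if_false, Nat.sub_self]
    rw [if_neg (by omega), Nat.add_sub_cancel_left, hlast]
    exact hq.1.trans hp.1.symm
  have hlt : l₁ < l₁ + (l₂ + 1) := by omega
  refine ⟨lasso l₁ (l₁ + (l₂ + 1)) π c (0, ν 0 h), ?_, fun i => ?_, ?_⟩
  · refine lasso_isBounded (hS := hS) (e := e) (J := fun k => (s (k - l₁)).2.1)
      (F := fun k => (s (k - l₁)).2.2) hlt (fun k hk => (hπc k hk).1)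
      (fun k hk hk' => (hπc k hk').2 hk) ?_ ?_ ?_ _
    · simp only [Nat.add_sub_cancel_left, Nat.sub_self, hlast]
      exact hq.2.trans hp.2.symm
    · intro j hj
      by_cases hj0 : j = 0
      · exact Or.inl hj0
      · right
        simp only [Nat.sub_self] at hj ⊢
        exact ⟨hj0, hj⟩
    · simp only [Nat.add_sub_cancel_left, hlast]
      exact hK _ (by omega)
  · have he0 : e 0 = E 0 := by
      rcases Nat.eq_zero_or_pos l₁ with h0 | h0
      · rw [show e 0 = (s (0 - l₁)).1 from if_neg (by omega), Nat.zero_sub]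
        rw [h0] at hs₁'
        exact hs₁'.symm.trans hs₁
      · rw [show e 0 = s₁ 0 from if_pos h0, hs₁]
    refine lasso_mul (hS := hS) (e := e) (β := ⟨b i, hb i⟩) (α := ⟨a i, ha i⟩) hlt
      (fun k hk => (hπc k hk).1) hel (by omega) ?_
    rw [he0]
    refine ⟨i, [], rfl, ?_, ?_, ?_, ?_⟩ <;> simp only [act_nil, state_nil]
  · refine (ncard_range_lasso_state_le hlt _).trans (Nat.mul_le_mul_right _ ?_)
    omega

end LevelSystem

end TreeAut

/-! ### Enumeration of words -/

/-- The list of all words of length `n` over the alphabet `l`. -/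
def tuples {α : Type*} (l : List α) : ℕ → List (List α)
  | 0 => [[]]
  | n + 1 => (tuples l n).flatMap fun w => l.map fun x => x :: w

theorem mem_tuples {α : Type*} {l : List α} {n : ℕ} {w : List α} :
    w ∈ tuples l n ↔ w.length = n ∧ ∀ x ∈ w, x ∈ l := by
  induction n generalizing w with
  | zero => cases w <;> simp [tuples]
  | succ n ih =>
    cases w with
    | nil => simp [tuples]
    | cons x w => simp [tuples, ih]; tauto

theorem nodup_tuples {α : Type*} {l : List α} (hl : l.Nodup) (n : ℕ) : (tuples l n).Nodup := by
  induction n with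
  | zero => simp [tuples]
  | succ n ih =>
    rw [tuples, List.nodup_flatMap]
    refine ⟨fun w _ => hl.map fun x y h => (List.cons.inj h).1, ih.imp fun hne => ?_⟩
    intro z hz hz'
    obtain ⟨x, -, rfl⟩ := List.mem_map.1 hz
    obtain ⟨y, -, h⟩ := List.mem_map.1 hz'
    exact hne (List.cons.inj h).2.symm

/-! ### Codes of automata, transition tables and certificates -/

namespace AutomatonCode

/-- The entry of the transition table `A` in the state `s` at the letter `x`. -/
def entry (A : List (List (ℕ × ℕ))) (s x : ℕ) : Option (ℕ × ℕ) := A[s]?.bind fun row => row[x]?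

/-- One step of the automaton with the transition table `A` on a pair which consists of the
current state and of the output up to now. -/
def step (A : List (List (ℕ × ℕ))) (o : Option (ℕ × List ℕ)) (x : ℕ) : Option (ℕ × List ℕ) :=
  o.bind fun p => (entry A p.1 x).map fun e => (e.2, p.2 ++ [e.1])

/-- The final state and the output of the automaton with the transition table `A` which is started
in the state `s` and reads the word `w`. -/
def exec (A : List (List (ℕ × ℕ))) (s : ℕ) (w : List ℕ) : Option (ℕ × List ℕ) :=
  w.foldl (step A) (some (s, []))

/-- The recursion of `run` changes the state argument; as a left fold it is visibly primitive
recursive, and the final state becomes available. -/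
theorem run_eq_exec (A : List (List (ℕ × ℕ))) (s : ℕ) (w : List ℕ) :
    run A s w = (exec A s w).map Prod.snd := by
  have hnone : ∀ w : List ℕ, w.foldl (step A) none = none := fun w => by
    induction w with
    | nil => rfl
    | cons x w ih => exact ih
  have key : ∀ (w : List ℕ) (s : ℕ) (u : List ℕ), (w.foldl (step A) (some (s, u))).map Prod.snd =
      (run A s w).map (u ++ ·) := by
    intro w
    induction w with
    | nil => intro s u; simp [run]
    | cons x w ih =>
      intro s u
      simp only [List.foldl_cons, run, step, Option.bind_some, entry]
      cases A[s]?.bind fun row => row[x]? with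
      | none => simp [hnone]
      | some e => simp [ih, Function.comp_def]
  rw [exec, key]
  simp

open TreeAut

variable {d : ℕ}

theorem Represents.letter {A : List (List (ℕ × ℕ))} {s : ℕ} {g : TreeAut d}
    (h : Represents (A, s) g) (x : Fin d) :
    ∃ t, entry A s x = some ((g.rootPerm x).val, t) ∧ Represents (A, t) (g.state [x]) := by
  have h1 := h [x]
  simp only [List.map_cons, List.map_nil, run, act_letter] at h1
  cases he : entry A s x with
  | none => rw [entry] at he; simp [he] at h1
  | some e =>
    rw [entry] at he
    simp only [he, Option.bind_some, Option.map_some, Option.some.injEq, List.cons.injEq,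
      and_true] at h1
    refine ⟨e.2, by rw [← h1], fun w => ?_⟩
    have h2 := h (x :: w)
    simp only [List.map_cons, run, he, Option.bind_some, act_cons, Option.map_eq_some_iff,
      List.cons.injEq] at h2
    obtain ⟨u, hu, -, rfl⟩ := h2
    exact hu

theorem Represents.state {A : List (List (ℕ × ℕ))} {s : ℕ} {g : TreeAut d}
    (h : Represents (A, s) g) (v : List (Fin d)) : ∃ t, Represents (A, t) (g.state v) := by
  induction v using List.reverseRecOn with
  | nil => exact ⟨s, by rwa [state_nil]⟩
  | append_singleton v x ih =>
    obtain ⟨t, ht⟩ := ih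
    obtain ⟨t', -, ht'⟩ := ht.letter x
    exact ⟨t', by rwa [state_append]⟩

theorem Represents.unique {c : AutomatonCode} {g g' : TreeAut d}
    (h : Represents c g) (h' : Represents c g') : g = g' :=
  ext_act fun w =>
    List.map_injective_iff.2 Fin.val_injective (Option.some.inj ((h w).symm.trans (h' w)))

theorem Represents.finite_and_ncard {c : AutomatonCode} {g : TreeAut d} (h : Represents c g) :
    g.IsFiniteState ∧ (Set.range g.state).ncard ≤ c.1.length + 1 := by
  classical
  let f : ℕ → TreeAut d := fun s => if H : ∃ g, Represents (c.1, s) g then H.choose else 1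
  have hf : ∀ s g, Represents (c.1, s) g → f s = g := fun s g hg => by
    have H : ∃ g, Represents (c.1, s) g := ⟨g, hg⟩
    simp only [f, dif_pos H]
    exact H.choose_spec.unique hg
  have hsub : Set.range g.state ⊆ f '' (Finset.range (c.1.length + 1) : Set ℕ) := by
    rintro _ ⟨v, rfl⟩
    obtain ⟨t, ht⟩ := Represents.state (A := c.1) (s := c.2) h v
    by_cases hlt : t < c.1.length
    · exact ⟨t, by simp; omega, hf _ _ ht⟩
    -- A row number outside the table can occur only over the empty alphabet, where all tree
    -- automorphisms coincide. The summand `1` in the bound keeps the index `0` available even for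
    -- the empty table.
    · refine ⟨0, by simp, ext_act fun w => ?_⟩
      cases w with
      | nil => rw [act_nil, act_nil]
      | cons x w =>
        obtain ⟨t', ht', -⟩ := ht.letter x
        simp [entry, List.getElem?_eq_none (not_lt.1 hlt)] at ht'
  have hfin : (f '' (Finset.range (c.1.length + 1) : Set ℕ)).Finite :=
    (Finset.finite_toSet _).image _
  refine ⟨hfin.subset hsub, (Set.ncard_le_ncard hsub hfin).trans
    ((Set.ncard_image_le (Finset.finite_toSet _)).trans ?_)⟩
  rw [Set.ncard_coe_finset, Finset.card_range]

theorem exec_machine {m : ℕ} {H : List (List (ℕ × ℕ))} {π : Fin m → Equiv.Perm (Fin d)}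
    {δ : Fin m → Fin d → Fin m}
    (hH : ∀ t x, entry H (t : Fin m) (x : Fin d) = some ((π t x).val, (δ t x).val)) (t : Fin m)
    (w : List (Fin d)) : exec H t (w.map Fin.val) =
      some ((w.foldl δ t).val, ((machine π δ t).act w).map Fin.val) := by
  induction w using List.reverseRecOn with
  | nil => rw [act_nil]; rfl
  | append_singleton w x ih =>
    rw [exec] at ih
    rw [exec, List.map_append, List.foldl_append, ih]
    simp only [List.map_cons, List.map_nil, List.foldl_cons, List.foldl_nil, step,
      Option.bind_some, hH, Option.map_some, List.foldl_append, act_snoc, List.map_append,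
      machine_state, machine_rootPerm]

theorem run_machine {m : ℕ} {H : List (List (ℕ × ℕ))} {π : Fin m → Equiv.Perm (Fin d)}
    {δ : Fin m → Fin d → Fin m}
    (hH : ∀ t x, entry H (t : Fin m) (x : Fin d) = some ((π t x).val, (δ t x).val)) (t : Fin m)
    (w : List (Fin d)) : run H t (w.map Fin.val) =
      some (((machine π δ t).act w).map Fin.val) := by
  rw [run_eq_exec, exec_machine hH, Option.map_some]

/-- The list of all transition tables with `m` states over the alphabet with `d` letters. -/
def tables (d m : ℕ) : List (List (List (ℕ × ℕ))) :=
  tuples (tuples ((List.range d).flatMap fun y => (List.range m).map fun t => (y, t)) d) m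

/-- The number of words of length `n` which the automaton with the transition table `H` and the
initial state `s` reads without arriving in the state `0`. -/
def countNonzero (d : ℕ) (H : List (List (ℕ × ℕ))) (s n : ℕ) : ℕ :=
  ((tuples (List.range d) n).filter fun w => (exec H s w).map Prod.fst ≠ some 0).length

/-- The finitely many conditions on a transition table `H` and an initial state `s` which say that
the automaton defines a bounded tree automorphism that solves the conjugacy equations given
by `l`. -/
structure IsCertificate (d m N T L : ℕ) (l : List (AutomatonCode × AutomatonCode))
    (H : List (List (ℕ × ℕ))) (s : ℕ) : Prop where
  zero : ∀ x < d, entry H 0 x = some (x, 0)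
  injective : ∀ t < m, ∀ x < d, ∀ x' < d,
    (entry H t x).map Prod.fst = (entry H t x').map Prod.fst → x = x'
  count : ∀ n < T, countNonzero d H s n ≤ N
  conj : ∀ q ∈ l, ∀ w ∈ tuples (List.range d) L,
    (run q.2.1 q.2.2 w).bind (run H s) = (run H s w).bind (run q.1.1 q.1.2)

theorem map_val_mem_tuples (w : List (Fin d)) :
    w.map Fin.val ∈ tuples (List.range d) w.length := by
  rw [mem_tuples]
  refine ⟨List.length_map _, fun x hx => ?_⟩
  obtain ⟨y, -, rfl⟩ := List.mem_map.1 hx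
  exact List.mem_range.2 y.2

theorem exists_map_val {n : ℕ} {w : List ℕ} (hw : w ∈ tuples (List.range d) n) :
    ∃ v : List (Fin d), v.length = n ∧ v.map Fin.val = w := by
  obtain ⟨h1, h2⟩ := mem_tuples.1 hw
  refine ⟨w.pmap (fun x hx => (⟨x, hx⟩ : Fin d)) fun x hx => List.mem_range.1 (h2 x hx), ?_, ?_⟩
  · rw [List.length_pmap, h1]
  · rw [List.map_pmap]
    simp

theorem exists_entry_of_mem_tables {m : ℕ} {H : List (List (ℕ × ℕ))} (hH : H ∈ tables d m) :
    ∃ e : Fin m → Fin d → Fin d × Fin m,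
      ∀ t x, entry H (t : Fin m) (x : Fin d) = some ((e t x).1.val, (e t x).2.val) := by
  obtain ⟨h1, h2⟩ := mem_tuples.1 hH
  have key : ∀ (t : Fin m) (x : Fin d), ∃ e : Fin d × Fin m,
      entry H t x = some (e.1.val, e.2.val) := by
    intro t x
    have ht : (t : ℕ) < H.length := h1 ▸ t.2
    obtain ⟨h3, h4⟩ := mem_tuples.1 (h2 _ (List.getElem_mem ht))
    have hx : (x : ℕ) < (H[(t : ℕ)]).length := h3 ▸ x.2
    obtain ⟨y, hy, hyt⟩ := List.mem_flatMap.1 (h4 _ (List.getElem_mem hx))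
    obtain ⟨z, hz, he⟩ := List.mem_map.1 hyt
    refine ⟨(⟨y, List.mem_range.1 hy⟩, ⟨z, List.mem_range.1 hz⟩), ?_⟩
    rw [entry, List.getElem?_eq_getElem ht, Option.bind_some, List.getElem?_eq_getElem hx, ← he]
  choose e he using key
  exact ⟨e, he⟩

theorem entry_ofFn {m : ℕ} (e : Fin m → Fin d → ℕ × ℕ) (t : Fin m) (x : Fin d) :
    entry (List.ofFn fun t => List.ofFn (e t)) t x = some (e t x) := by
  simp [entry]

theorem ofFn_mem_tables {m : ℕ} (e : Fin m → Fin d → Fin d × Fin m) :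
    (List.ofFn fun t => List.ofFn fun x => ((e t x).1.val, (e t x).2.val)) ∈ tables d m := by
  rw [tables, mem_tuples]
  refine ⟨List.length_ofFn, fun r hr => ?_⟩
  obtain ⟨t, rfl⟩ := (List.mem_ofFn' _ _).1 hr
  rw [mem_tuples]
  refine ⟨List.length_ofFn, fun q hq => ?_⟩
  obtain ⟨x, rfl⟩ := (List.mem_ofFn' _ _).1 hq
  exact List.mem_flatMap.2 ⟨_, List.mem_range.2 (e t x).1.2,
    List.mem_map.2 ⟨_, List.mem_range.2 (e t x).2.2, rfl⟩⟩

/-- A non-trivial state cannot be row `0`, so the computable count dominates the number of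
non-trivial states. Other rows may be trivial too, hence only an inequality. -/
theorem ncard_supp_le_countNonzero {m : ℕ} {H : List (List (ℕ × ℕ))}
    {π : Fin (m + 1) → Equiv.Perm (Fin d)} {δ : Fin (m + 1) → Fin d → Fin (m + 1)}
    (hH : ∀ t x, entry H (t : Fin (m + 1)) (x : Fin d) = some ((π t x).val, (δ t x).val))
    (h0 : machine π δ 0 = 1) (t : Fin (m + 1)) (n : ℕ) :
    (supp n (machine π δ t)).ncard ≤ countNonzero d H t n := by
  classical
  rw [countNonzero]
  refine le_trans ?_ (List.toFinset_card_le _)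
  rw [← Set.ncard_coe_finset]
  refine Set.ncard_le_ncard_of_injOn (List.map Fin.val) (fun v hv => ?_)
    (List.map_injective_iff.2 Fin.val_injective).injOn (Finset.finite_toSet _)
  rw [Finset.mem_coe, List.mem_toFinset, List.mem_filter]
  refine ⟨hv.1 ▸ map_val_mem_tuples v, ?_⟩
  rw [exec_machine hH]
  simp only [Option.map_some, ne_eq, Option.some.injEq, decide_eq_true_eq]
  intro h
  refine hv.2 ?_
  rw [machine_state, show v.foldl δ t = 0 from Fin.ext h, h0]

theorem countNonzero_le_ncard {m : ℕ} {H : List (List (ℕ × ℕ))}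
    {π : Fin (m + 1) → Equiv.Perm (Fin d)} {δ : Fin (m + 1) → Fin d → Fin (m + 1)}
    (hH : ∀ t x, entry H (t : Fin (m + 1)) (x : Fin d) = some ((π t x).val, (δ t x).val))
    (t : Fin (m + 1)) (n : ℕ) :
    countNonzero d H t n ≤
      {v : List (Fin d) | v.length = n ∧ v.foldl δ t ≠ 0}.ncard := by
  classical
  rw [countNonzero, ← List.toFinset_card_of_nodup ((nodup_tuples List.nodup_range n).filter _),
    ← Set.ncard_coe_finset]
  have hfin : {v : List (Fin d) | v.length = n ∧ v.foldl δ t ≠ 0}.Finite :=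
    finite_of_length fun v hv => hv.1
  refine le_trans (Set.ncard_le_ncard ?_ (hfin.image (List.map Fin.val)))
    (Set.ncard_image_le hfin)
  intro w hw
  rw [Finset.mem_coe, List.mem_toFinset, List.mem_filter] at hw
  obtain ⟨v, hv, rfl⟩ := exists_map_val hw.1
  refine ⟨v, ⟨hv, fun h => ?_⟩, rfl⟩
  have := hw.2
  rw [exec_machine hH, h] at this
  simp at this

end AutomatonCode

/-! ### Equality of finite-state automorphisms from a single level -/

namespace TreeAut

variable {d : ℕ}

/-- Two finite-state tree automorphisms which agree on a sufficiently deep level are equal. -/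
theorem eq_of_act_eq_on_level {g g' : TreeAut d} (hg : g.IsFiniteState) (hg' : g'.IsFiniteState)
    {M M' L : ℕ} (hM : (Set.range g.state).ncard ≤ M) (hM' : (Set.range g'.state).ncard ≤ M')
    (hL : M * M' ≤ L) (h : ∀ w : List (Fin d), w.length = L → g.act w = g'.act w) : g = g' := by
  have hle : ∀ w : List (Fin d), w.length ≤ L → g.act w = g'.act w := by
    intro w hw
    cases w with
    | nil => rw [act_nil, act_nil]
    | cons x w =>
      have := congrArg (List.take (x :: w).length)
        (h ((x :: w) ++ List.replicate (L - (x :: w).length) x) (by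
          rw [List.length_append, List.length_replicate]; omega))
      rwa [take_act, take_act, List.take_left] at this
  have key : ∀ n, ∀ w : List (Fin d), w.length = n → g.act w = g'.act w := by
    intro n
    induction n using Nat.strong_induction_on with
    | _ n ih =>
      intro w hw
      rcases le_or_gt n L with hn | hn
      · exact hle w (hw ▸ hn)
      have hcard : (hg.toFinset ×ˢ hg'.toFinset).card < (Finset.range (L + 1)).card := by
        rw [Finset.card_product, ← Set.ncard_eq_toFinset_card _ hg,
          ← Set.ncard_eq_toFinset_card _ hg', Finset.card_range]
        exact Nat.lt_succ_of_le ((Nat.mul_le_mul hM hM').trans hL)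
      -- Pumping: along a word longer than `L` the pair of states repeats within the first `L`
      -- letters. Cutting out the segment in between gives a shorter word with the same remaining
      -- action.
      obtain ⟨i, hi, j, hj, hne, heq⟩ := Finset.exists_ne_map_eq_of_card_lt_of_maps_to hcard
        (f := fun i => (g.state (w.take i), g'.state (w.take i))) fun i _ => by
          rw [Finset.mem_coe, Finset.mem_product]
          exact ⟨hg.mem_toFinset.2 ⟨_, rfl⟩, hg'.mem_toFinset.2 ⟨_, rfl⟩⟩
      wlog hij : i < j generalizing i j
      · exact this j hj i hi hne.symm heq.symm (lt_of_le_of_ne (not_lt.1 hij) hne.symm)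
      rw [Finset.mem_range] at hi hj
      obtain ⟨e, e'⟩ := Prod.mk.inj heq
      have h1 := ih (w.take i ++ w.drop j).length
        (by rw [List.length_append, List.length_take, List.length_drop]; omega) _ rfl
      rw [act_append, act_append, hle (w.take i) (by rw [List.length_take]; omega), e, e'] at h1
      conv_lhs => rw [← List.take_append_drop j w]
      conv_rhs => rw [← List.take_append_drop j w]
      rw [act_append, act_append, List.append_cancel_left h1,
        hle (w.take j) (by rw [List.length_take]; omega)]
  exact ext_act fun w => key _ w rfl

theorem finite_and_ncard_mul {g h : TreeAut d} (hg : g.IsFiniteState) (hh : h.IsFiniteState)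
    {M M' : ℕ} (hM : (Set.range g.state).ncard ≤ M) (hM' : (Set.range h.state).ncard ≤ M') :
    (g * h).IsFiniteState ∧ (Set.range (g * h).state).ncard ≤ M * M' := by
  have hfin : (Set.range g.state ×ˢ Set.range h.state).Finite := hg.prod hh
  have hsub : Set.range (g * h).state ⊆
      (fun p : TreeAut d × TreeAut d => p.1 * p.2) '' (Set.range g.state ×ˢ Set.range h.state) := by
    rintro _ ⟨v, rfl⟩
    exact ⟨(g.state (h.act v), h.state v), ⟨⟨_, rfl⟩, ⟨_, rfl⟩⟩, (state_mul _ _ _).symm⟩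
  refine ⟨(hfin.image _).subset hsub, (Set.ncard_le_ncard hsub (hfin.image _)).trans
    ((Set.ncard_image_le hfin).trans ?_)⟩
  rw [Set.ncard_prod]
  exact Nat.mul_le_mul hM hM'

end TreeAut

/-! ### Certificates exist exactly for conjugate tuples -/

namespace AutomatonCode

open TreeAut

variable {d k : ℕ} {a b : Fin k → TreeAut d} {A B : Fin k → AutomatonCode}

/-- Soundness: `T` exceeds the last level needed by `ncard_supp_le` for `m + 1` states, and `L` is
at least the product of the bounds on the numbers of states of `h * b i` and `a i * h`. -/
theorem IsCertificate.exists_isBounded {m N T L s : ℕ}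
    (hA : ∀ i, Represents (A i) (a i)) (hB : ∀ i, Represents (B i) (b i))
    (ha : ∀ i, (Set.range (a i).state).ncard ≤ s) (hb : ∀ i, (Set.range (b i).state).ncard ≤ s)
    {H : List (List (ℕ × ℕ))} (hH : H ∈ tables d (m + 1)) {t : ℕ} (ht : t < m + 1)
    (hT : (m + 1) * (N + 2) < T) (hL : (m + 1) * s * (s * (m + 1)) ≤ L)
    (hc : IsCertificate d (m + 1) N T L (List.ofFn fun i => (A i, B i)) H t) :
    ∃ h : TreeAut d, h.IsBounded ∧ ∀ i, h * b i = a i * h := by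
  obtain ⟨e, he⟩ := exists_entry_of_mem_tables hH
  have hinj : ∀ t, Function.Injective fun x => (e t x).1 := fun t x x' h => by
    refine Fin.ext (hc.injective t t.2 x x.2 x' x'.2 ?_)
    rw [he, he]
    simpa using congrArg Fin.val h
  let π : Fin (m + 1) → Equiv.Perm (Fin d) := fun t =>
    Equiv.ofBijective _ (Finite.injective_iff_bijective.1 (hinj t))
  let δ : Fin (m + 1) → Fin d → Fin (m + 1) := fun t x => (e t x).2
  have hE : ∀ t x, entry H (t : Fin (m + 1)) (x : Fin d) = some ((π t x).val, (δ t x).val) := he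
  have h0 : ∀ x : Fin d, π 0 x = x ∧ δ 0 x = 0 := fun x => by
    have h1 := hc.zero x x.2
    have h2 := hE 0 x
    rw [Fin.val_zero, h1] at h2
    simp only [Option.some.injEq, Prod.mk.injEq] at h2
    exact ⟨Fin.ext h2.1.symm, Fin.ext h2.2.symm⟩
  have hz : machine π δ 0 = 1 := machine_eq_one π δ fun v => by
    have : v.foldl δ 0 = 0 := by
      induction v with
      | nil => rfl
      | cons x v ih => rw [List.foldl_cons, (h0 x).2, ih]
    rw [this]
    exact Equiv.ext fun x => (h0 x).1
  set h := machine π δ ⟨t, ht⟩ with hh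
  have hsub : Set.range h.state ⊆ Set.range (machine π δ) := by
    rintro _ ⟨v, rfl⟩
    exact ⟨_, (machine_state _ _ _ _).symm⟩
  have hfin : h.IsFiniteState := (Set.finite_range _).subset hsub
  have hcard : (Set.range h.state).ncard ≤ m + 1 := by
    refine (Set.ncard_le_ncard hsub (Set.finite_range _)).trans ?_
    rw [← Set.image_univ]
    refine (Set.ncard_image_le Set.finite_univ).trans ?_
    rw [Set.ncard_univ, Nat.card_eq_fintype_card, Fintype.card_fin]
  refine ⟨h, isBounded_of_supp hfin (ncard_supp_le hfin hcard (N := N) fun n hn => ?_),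
    fun i => ?_⟩
  · exact (ncard_supp_le_countNonzero hE hz _ n).trans (hc.count n (by omega))
  · obtain ⟨f1, c1⟩ := finite_and_ncard_mul hfin (hB i).finite_and_ncard.1 hcard (hb i)
    obtain ⟨f2, c2⟩ := finite_and_ncard_mul (hA i).finite_and_ncard.1 hfin (ha i) hcard
    refine eq_of_act_eq_on_level f1 f2 c1 c2 hL fun w hw => ?_
    have hq := hc.conj (A i, B i) ((List.mem_ofFn' _ _).2 ⟨i, rfl⟩) (w.map Fin.val)
      (hw ▸ map_val_mem_tuples w)
    have hrun := run_machine hE ⟨t, ht⟩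
    simp only at hq hrun
    rw [hB i w, Option.bind_some, hrun, hrun, Option.bind_some, hA i, Option.some.injEq] at hq
    exact List.map_injective_iff.2 Fin.val_injective hq

/-- Completeness: the states of `h` are the rows of the table, with the trivial automorphism as row
`0`; this accounts for `m + 1` rows. The activity count holds on all levels by
`IsBounded.ncard_supp_le`, so `T` and `L` are arbitrary. -/
theorem exists_isCertificate {m N : ℕ} (T L : ℕ)
    (hA : ∀ i, Represents (A i) (a i)) (hB : ∀ i, Represents (B i) (b i)) {h : TreeAut d}
    (hb : h.IsBounded) (hm : (Set.range h.state).ncard ≤ m) (hN : (d + 1) ^ (2 * m) ≤ N)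
    (hconj : ∀ i, h * b i = a i * h) : ∃ H ∈ tables d (m + 1), ∃ t < m + 1,
      IsCertificate d (m + 1) N T L (List.ofFn fun i => (A i, B i)) H t := by
  classical
  set s := insert 1 (Set.range h.state) with hs
  have hsfin : s.Finite := hb.1.insert 1
  obtain ⟨ν, h1, hν⟩ := exists_injOn_fin hsfin ((Set.ncard_insert_le _ _).trans
    (Nat.add_le_add_right hm 1))
  let rep : Fin (m + 1) → TreeAut d := fun j => if H : ∃ g ∈ s, ν g = j then H.choose else 1
  have hrep_mem : ∀ j, rep j ∈ s := fun j => by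
    by_cases H : ∃ g ∈ s, ν g = j
    · simp only [rep, dif_pos H]
      exact H.choose_spec.1
    · simp only [rep, dif_neg H]
      exact Set.mem_insert _ _
  have hrep : ∀ g ∈ s, rep (ν g) = g := fun g hg => by
    have H : ∃ g' ∈ s, ν g' = ν g := ⟨g, hg, rfl⟩
    simp only [rep, dif_pos H]
    exact hν H.choose_spec.1 hg H.choose_spec.2
  have hclosed : ∀ g ∈ s, ∀ v, g.state v ∈ s := by
    rintro g (rfl | ⟨w, rfl⟩) v
    · rw [state_one]; exact Set.mem_insert _ _
    · rw [← state_append]; exact Or.inr ⟨_, rfl⟩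
  let π : Fin (m + 1) → Equiv.Perm (Fin d) := fun j => (rep j).rootPerm
  let δ : Fin (m + 1) → Fin d → Fin (m + 1) := fun j x => ν ((rep j).state [x])
  have hmach : ∀ j, machine π δ j = rep j := fun j => by
    refine eq_of_bisim (fun g g' => ∃ j, g = machine π δ j ∧ g' = rep j) ?_ ?_ ⟨j, rfl, rfl⟩
    · rintro _ _ ⟨j, rfl, rfl⟩ x
      rw [machine_rootPerm]
    · rintro _ _ ⟨j, rfl, rfl⟩ x
      exact ⟨_, machine_state_letter _ _ _ _, (hrep _ (hclosed _ (hrep_mem j) _)).symm⟩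
  have hh : h ∈ s := Or.inr ⟨[], state_nil h⟩
  have hmh : machine π δ (ν h) = h := by rw [hmach, hrep h hh]
  have h0 : rep 0 = 1 := by rw [← h1]; exact hrep 1 (Set.mem_insert _ _)
  have hE := fun t x => entry_ofFn (fun t x => ((π t x).val, (δ t x).val)) t x
  refine ⟨_, ofFn_mem_tables fun t x => (π t x, δ t x), ν h, (ν h).2, ?_, ?_, ?_, ?_⟩
  · intro x hx
    have := hE 0 ⟨x, hx⟩
    simp only [π, δ, h0, rootPerm_one, state_one, h1] at this
    exact this
  · intro t ht x hx x' hx' heq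
    have e1 := hE ⟨t, ht⟩ ⟨x, hx⟩
    have e2 := hE ⟨t, ht⟩ ⟨x', hx'⟩
    simp only at e1 e2
    simp only [e1, e2, Option.map_some, Option.some.injEq, Fin.val_inj,
      EmbeddingLike.apply_eq_iff_eq, Fin.mk.injEq] at heq
    exact heq
  · intro n _
    refine (countNonzero_le_ncard hE (ν h) n).trans (le_trans ?_
      ((hb.ncard_supp_le hm n).trans hN))
    refine Set.ncard_le_ncard (fun v hv => ⟨hv.1, fun h2 => hv.2 ?_⟩) (supp_finite _ _)
    have key : ∀ v : List (Fin d), v.foldl δ (ν h) = ν (h.state v) := fun v => by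
      induction v using List.reverseRecOn with
      | nil => rw [state_nil]; rfl
      | append_singleton v x ih =>
        rw [List.foldl_append, ih, List.foldl_cons, List.foldl_nil, state_append]
        simp only [δ]
        rw [hrep _ (hclosed h hh v)]
    rw [key, h2, h1]
  · intro q hq w hw
    obtain ⟨i, rfl⟩ := (List.mem_ofFn' _ _).1 hq
    obtain ⟨v, -, rfl⟩ := exists_map_val hw
    have hrun := run_machine hE (ν h)
    rw [hmh] at hrun
    rw [show run (A i, B i).2.1 (A i, B i).2.2 (v.map Fin.val) = _ from hB i v, hrun,
      Option.bind_some, Option.bind_some, hrun,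
      show run (A i, B i).1.1 (A i, B i).1.2 _ = _ from hA i (h.act v), ← act_mul, ← act_mul,
      hconj]

end AutomatonCode

/-! ### Primitive recursive predicates with bounded quantifiers -/

section Quantifiers

variable {α β : Type*} [Primcodable α] [Primcodable β]

theorem PrimrecPred.forall_mem {l : α → List β} {p : α → β → Prop} (hl : Primrec l)
    (hp : PrimrecPred fun q : α × β => p q.1 q.2) : PrimrecPred fun a => ∀ b ∈ l a, p a b :=
  have h : PrimrecRel fun (b : β) (a : α) => p a b := hp.comp (Primrec.snd.pair Primrec.fst)
  h.forall_mem_list.comp hl Primrec.id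

theorem PrimrecPred.exists_mem {l : α → List β} {p : α → β → Prop} (hl : Primrec l)
    (hp : PrimrecPred fun q : α × β => p q.1 q.2) : PrimrecPred fun a => ∃ b ∈ l a, p a b :=
  have h : PrimrecRel fun (b : β) (a : α) => p a b := hp.comp (Primrec.snd.pair Primrec.fst)
  h.exists_mem_list.comp hl Primrec.id

theorem PrimrecPred.forall_lt' {n : α → ℕ} {p : α → ℕ → Prop} (hn : Primrec n)
    (hp : PrimrecPred fun q : α × ℕ => p q.1 q.2) : PrimrecPred fun a => ∀ x < n a, p a x :=
  (PrimrecPred.forall_mem (Primrec.list_range.comp hn) hp).of_eq fun a => by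
    simp only [List.mem_range]

theorem PrimrecPred.exists_lt' {n : α → ℕ} {p : α → ℕ → Prop} (hn : Primrec n)
    (hp : PrimrecPred fun q : α × ℕ => p q.1 q.2) : PrimrecPred fun a => ∃ x < n a, p a x :=
  (PrimrecPred.exists_mem (Primrec.list_range.comp hn) hp).of_eq fun a => by
    simp only [List.mem_range]

theorem Primrec.list_filter' {l : α → List β} {p : α → β → Prop} [∀ a, DecidablePred (p a)]
    (hl : Primrec l) (hp : PrimrecPred fun q : α × β => p q.1 q.2) :
    Primrec fun a => (l a).filter fun b => p a b := by
  have h : PrimrecRel fun (b : β) (a : α) => p a b := hp.comp (Primrec.snd.pair Primrec.fst)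
  have : DecidableRel fun (b : β) (a : α) => p a b := fun b a => inferInstance
  exact (h.listFilter.comp hl Primrec.id).of_eq fun a => by congr!

theorem Primrec.nat_pow : Primrec₂ ((· ^ ·) : ℕ → ℕ → ℕ) :=
  Primrec₂.unpaired'.1 Nat.Primrec.pow

theorem Primrec.tuples {l : α → List β} {n : α → ℕ} (hl : Primrec l) (hn : Primrec n) :
    Primrec fun a => tuples (l a) (n a) := by
  have hstep : Primrec₂ fun (a : α) (q : ℕ × List (List β)) =>
      q.2.flatMap fun w => (l a).map fun x => x :: w :=
    Primrec.list_flatMap (Primrec.snd.comp Primrec.snd)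
      (Primrec.list_map (hl.comp (Primrec.fst.comp Primrec.fst))
        (Primrec.list_cons.comp Primrec.snd (Primrec.snd.comp Primrec.fst)).to₂).to₂
  refine (Primrec.nat_rec' hn (Primrec.const [[]]) hstep).of_eq fun a => ?_
  induction n a with
  | zero => rfl
  | succ n ih => rw [_root_.tuples, ← ih]

end Quantifiers

/-! ### The certificate test is primitive recursive -/

namespace AutomatonCode

variable {α : Type*} [Primcodable α] {A : α → List (List (ℕ × ℕ))} {s x : α → ℕ}
  {w : α → List ℕ}

theorem primrec_entry (hA : Primrec A) (hs : Primrec s) (hx : Primrec x) :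
    Primrec fun a => entry (A a) (s a) (x a) :=
  Primrec.option_bind (Primrec.list_getElem?.comp hA hs)
    (Primrec.list_getElem?.comp Primrec.snd (hx.comp Primrec.fst)).to₂

theorem primrec_exec (hA : Primrec A) (hs : Primrec s) (hw : Primrec w) :
    Primrec fun a => exec (A a) (s a) (w a) := by
  have hstep : Primrec₂ fun (a : α) (q : Option (ℕ × List ℕ) × ℕ) => step (A a) q.1 q.2 :=
    Primrec.option_bind (Primrec.fst.comp Primrec.snd)
      (Primrec.option_map (primrec_entry (hA.comp (Primrec.fst.comp Primrec.fst))
        (Primrec.fst.comp Primrec.snd) (Primrec.snd.comp (Primrec.snd.comp Primrec.fst)))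
        (Primrec.pair (Primrec.snd.comp Primrec.snd)
          (Primrec.list_concat.comp (Primrec.snd.comp (Primrec.snd.comp Primrec.fst))
            (Primrec.fst.comp Primrec.snd))).to₂).to₂
  exact Primrec.list_foldl hw
    (Primrec.option_some.comp (Primrec.pair hs (Primrec.const []))) hstep

theorem primrec_run (hA : Primrec A) (hs : Primrec s) (hw : Primrec w) :
    Primrec fun a => run (A a) (s a) (w a) :=
  (Primrec.option_map (primrec_exec hA hs hw) (Primrec.snd.comp Primrec.snd).to₂).of_eq
    fun _ => (run_eq_exec _ _ _).symm

theorem primrec_countNonzero {d n : α → ℕ} (hd : Primrec d) (hA : Primrec A) (hs : Primrec s)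
    (hn : Primrec n) : Primrec fun a => countNonzero (d a) (A a) (s a) (n a) := by
  classical
  refine (Primrec.list_length.comp (Primrec.list_filter'
    (p := fun a w => ¬ (exec (A a) (s a) w).map Prod.fst = some 0)
    (Primrec.tuples (Primrec.list_range.comp hd) hn)
    (PrimrecPred.not (Primrec.eq.comp (Primrec.option_map
      (primrec_exec (hA.comp Primrec.fst) (hs.comp Primrec.fst) Primrec.snd)
      (Primrec.fst.comp Primrec.snd).to₂) (Primrec.const _))))).of_eq fun a => ?_
  rw [countNonzero]

theorem primrec_tables {d m : α → ℕ} (hd : Primrec d) (hm : Primrec m) :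
    Primrec fun a => tables (d a) (m a) :=
  Primrec.tuples (Primrec.tuples (Primrec.list_flatMap (Primrec.list_range.comp hd)
    (Primrec.list_map (Primrec.list_range.comp (hm.comp Primrec.fst))
      (Primrec.pair (Primrec.snd.comp Primrec.fst) Primrec.snd).to₂).to₂) hd) hm

/-- The implication is written as a disjunction to fit the closure properties of `PrimrecPred`. -/
theorem isCertificate_iff {d m N T L : ℕ} {l : List (AutomatonCode × AutomatonCode)}
    {H : List (List (ℕ × ℕ))} {s : ℕ} : IsCertificate d m N T L l H s ↔
      (∀ x < d, entry H 0 x = some (x, 0)) ∧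
      (∀ t < m, ∀ x < d, ∀ x' < d,
        ¬ (entry H t x).map Prod.fst = (entry H t x').map Prod.fst ∨ x = x') ∧
      (∀ n < T, countNonzero d H s n ≤ N) ∧
      ∀ q ∈ l, ∀ w ∈ tuples (List.range d) L,
        (run q.2.1 q.2.2 w).bind (run H s) = (run H s w).bind (run q.1.1 q.1.2) := by
  simp only [← imp_iff_not_or]
  exact ⟨fun h => ⟨h.1, h.2, h.3, h.4⟩, fun h => ⟨h.1, h.2.1, h.2.2.1, h.2.2.2⟩⟩

theorem primrecPred_isCertificate {d m N T L : α → ℕ}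
    {l : α → List (AutomatonCode × AutomatonCode)} (hd : Primrec d) (hm : Primrec m)
    (hN : Primrec N) (hT : Primrec T) (hL : Primrec L) (hl : Primrec l) (hA : Primrec A)
    (hs : Primrec s) :
    PrimrecPred fun a => IsCertificate (d a) (m a) (N a) (T a) (L a) (l a) (A a) (s a) := by
  have h1 : PrimrecPred fun a => ∀ x < d a, entry (A a) 0 x = some (x, 0) :=
    PrimrecPred.forall_lt' hd (Primrec.eq.comp
      (primrec_entry (hA.comp Primrec.fst) (Primrec.const 0) Primrec.snd)
      (Primrec.option_some.comp (Primrec.pair Primrec.snd (Primrec.const 0))))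
  have h2 : PrimrecPred fun a => ∀ t < m a, ∀ x < d a, ∀ x' < d a,
      ¬ (entry (A a) t x).map Prod.fst = (entry (A a) t x').map Prod.fst ∨ x = x' := by
    have hd' := hd.comp (Primrec.fst (α := α) (β := ℕ))
    have hd'' := hd'.comp (Primrec.fst (α := α × ℕ) (β := ℕ))
    refine PrimrecPred.forall_lt' hm (PrimrecPred.forall_lt' hd' (PrimrecPred.forall_lt' hd'' ?_))
    have hA' : Primrec fun q : ((α × ℕ) × ℕ) × ℕ => A q.1.1.1 :=
      hA.comp (Primrec.fst.comp (Primrec.fst.comp Primrec.fst))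
    have ht : Primrec fun q : ((α × ℕ) × ℕ) × ℕ => q.1.1.2 :=
      Primrec.snd.comp (Primrec.fst.comp Primrec.fst)
    have hx : Primrec fun q : ((α × ℕ) × ℕ) × ℕ => q.1.2 := Primrec.snd.comp Primrec.fst
    exact PrimrecPred.or (PrimrecPred.not (Primrec.eq.comp
      (Primrec.option_map (primrec_entry hA' ht hx) (Primrec.fst.comp Primrec.snd).to₂)
      (Primrec.option_map (primrec_entry hA' ht Primrec.snd) (Primrec.fst.comp Primrec.snd).to₂)))
      (Primrec.eq.comp hx Primrec.snd)
  have h3 : PrimrecPred fun a => ∀ n < T a, countNonzero (d a) (A a) (s a) n ≤ N a :=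
    PrimrecPred.forall_lt' hT (Primrec.nat_le.comp
      (primrec_countNonzero (hd.comp Primrec.fst) (hA.comp Primrec.fst) (hs.comp Primrec.fst)
        Primrec.snd) (hN.comp Primrec.fst))
  have h4 : PrimrecPred fun a => ∀ q ∈ l a, ∀ w ∈ tuples (List.range (d a)) (L a),
      (run q.2.1 q.2.2 w).bind (run (A a) (s a)) =
        (run (A a) (s a) w).bind (run q.1.1 q.1.2) := by
    refine PrimrecPred.forall_mem hl (PrimrecPred.forall_mem (Primrec.tuples
      (Primrec.list_range.comp (hd.comp Primrec.fst)) (hL.comp Primrec.fst)) ?_)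
    have hA' : Primrec fun q : (α × (AutomatonCode × AutomatonCode)) × List ℕ => A q.1.1 :=
      hA.comp (Primrec.fst.comp Primrec.fst)
    have hs' : Primrec fun q : (α × (AutomatonCode × AutomatonCode)) × List ℕ => s q.1.1 :=
      hs.comp (Primrec.fst.comp Primrec.fst)
    have ha : Primrec fun q : (α × (AutomatonCode × AutomatonCode)) × List ℕ => q.1.2.1 :=
      Primrec.fst.comp (Primrec.snd.comp Primrec.fst)
    have hb : Primrec fun q : (α × (AutomatonCode × AutomatonCode)) × List ℕ => q.1.2.2 :=
      Primrec.snd.comp (Primrec.snd.comp Primrec.fst)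
    exact Primrec.eq.comp
      (Primrec.option_bind (primrec_run (Primrec.fst.comp hb) (Primrec.snd.comp hb) Primrec.snd)
        (primrec_run (hA'.comp Primrec.fst) (hs'.comp Primrec.fst) Primrec.snd).to₂)
      (Primrec.option_bind (primrec_run hA' hs' Primrec.snd)
        (primrec_run ((Primrec.fst.comp ha).comp Primrec.fst)
          ((Primrec.snd.comp ha).comp Primrec.fst) Primrec.snd).to₂)
  exact (h1.and (h2.and (h3.and h4))).of_eq fun a => isCertificate_iff.symm

/-! ### Explicit bounds computed from the codes -/

/-- A bound on the number of all states of the automorphisms with the given codes. -/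
def codeBound (l : List (AutomatonCode × AutomatonCode)) : ℕ :=
  (l.map fun q => q.1.1.length + q.2.1.length + 2).sum + 1

/-- A bound on the number of systems of equations with coefficients in a set with `s` elements
and `r` unknowns. -/
def systemBound (s r : ℕ) : ℕ := 2 ^ (r * (s * (s * r)))

/-- The number of unknowns, including the trivial one, of the systems of equations which have to be
considered. -/
def unknownBound (d k s : ℕ) : ℕ := 4 * k * (d + 1) ^ (2 * s) + 1

/-- A bound on the number of states of a conjugator. -/
def conjugatorBound (s r : ℕ) : ℕ :=
  (systemBound s r + (systemBound s r * (2 ^ r * 2 ^ r) + 1)) * r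

theorem primrec_codeBound : Primrec codeBound := by
  have h : Primrec fun l : List (AutomatonCode × AutomatonCode) =>
      l.map fun q => q.1.1.length + q.2.1.length + 2 :=
    Primrec.list_map Primrec.id (Primrec.nat_add.comp (Primrec.nat_add.comp
      (Primrec.list_length.comp (Primrec.fst.comp (Primrec.fst.comp Primrec.snd)))
      (Primrec.list_length.comp (Primrec.fst.comp (Primrec.snd.comp Primrec.snd))))
      (Primrec.const 2)).to₂
  exact Primrec.succ.comp ((Primrec.list_foldr h (Primrec.const 0)
    (Primrec.nat_add.comp (Primrec.fst.comp Primrec.snd) (Primrec.snd.comp Primrec.snd)).to₂).of_eq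
      fun l => List.sum_eq_foldr.symm)

theorem primrec_systemBound {s r : α → ℕ} (hs : Primrec s) (hr : Primrec r) :
    Primrec fun a => systemBound (s a) (r a) :=
  Primrec.nat_pow.comp (Primrec.const 2)
    (Primrec.nat_mul.comp hr (Primrec.nat_mul.comp hs (Primrec.nat_mul.comp hs hr)))

theorem primrec_unknownBound {d k s : α → ℕ} (hd : Primrec d) (hk : Primrec k)
    (hs : Primrec s) : Primrec fun a => unknownBound (d a) (k a) (s a) :=
  Primrec.succ.comp (Primrec.nat_mul.comp (Primrec.nat_mul.comp (Primrec.const 4) hk)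
    (Primrec.nat_pow.comp (Primrec.succ.comp hd) (Primrec.nat_mul.comp (Primrec.const 2) hs)))

theorem primrec_conjugatorBound {s r : α → ℕ} (hs : Primrec s) (hr : Primrec r) :
    Primrec fun a => conjugatorBound (s a) (r a) :=
  have h2 : Primrec fun a => 2 ^ r a := Primrec.nat_pow.comp (Primrec.const 2) hr
  Primrec.nat_mul.comp (Primrec.nat_add.comp (primrec_systemBound hs hr)
    (Primrec.succ.comp (Primrec.nat_mul.comp (primrec_systemBound hs hr)
      (Primrec.nat_mul.comp h2 h2)))) hr

end AutomatonCode

namespace TreeAut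

open AutomatonCode

theorem card_eqSystem_le {d : ℕ} {S : Set (TreeAut d)} (hS : S.Finite) {s : ℕ}
    (hs : S.ncard ≤ s) (R : ℕ) : Nat.card (EqSystem S R) ≤ systemBound s (R + 1) := by
  have : Finite S := hS
  have : Fintype S := Fintype.ofFinite S
  rw [EqSystem, Nat.card_eq_fintype_card, Fintype.card_set, Fintype.card_prod,
    Fintype.card_prod, Fintype.card_prod, Fintype.card_fin, ← Nat.card_eq_fintype_card,
    Nat.card_coe_set_eq]
  exact Nat.pow_le_pow_right (by norm_num) (by gcongr)

/-- The coefficients are taken from the self-similar set of all states of the `a i` and `b i`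
together with `1`. With at most `s` states each, these have at most `(d + 1) ^ (2 * s)` non-trivial
states on a level, which is the constant that trimming turns into `unknownBound`. -/
theorem exists_conj_of_codes {d k : ℕ} {a b : Fin k → TreeAut d} {A B : Fin k → AutomatonCode}
    (hA : ∀ i, Represents (A i) (a i)) (hB : ∀ i, Represents (B i) (b i))
    (ha : ∀ i, (a i).IsBounded) (hb : ∀ i, (b i).IsBounded) {s : ℕ}
    (hs : codeBound (List.ofFn fun i => (A i, B i)) ≤ s) :
    (∀ i, (Set.range (a i).state).ncard ≤ s ∧ (Set.range (b i).state).ncard ≤ s) ∧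
    ∀ h : TreeAut d, h.IsBounded → (∀ i, h * b i = a i * h) →
      ∃ h' : TreeAut d, h'.IsBounded ∧ (∀ i, h' * b i = a i * h') ∧
        (Set.range h'.state).ncard ≤ conjugatorBound s (unknownBound d k s) := by
  set S : Set (TreeAut d) :=
    insert 1 (⋃ i, Set.range (a i).state ∪ Set.range (b i).state) with hSdef
  have hfin : S.Finite :=
    (Set.finite_iUnion fun i => (ha i).1.union (hb i).1).insert 1
  have hcard : S.ncard ≤ s := by
    refine le_trans ((Set.ncard_insert_le _ _).trans (Nat.add_le_add_right ?_ 1)) hs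
    refine (Set.ncard_iUnion_le_of_fintype _).trans ?_
    rw [List.map_ofFn, List.sum_ofFn]
    refine Finset.sum_le_sum fun i _ => (Set.ncard_union_le _ _).trans ?_
    have h1 := (hA i).finite_and_ncard.2
    have h2 := (hB i).finite_and_ncard.2
    simp only [Function.comp_apply]
    omega
  have hsa : ∀ i, Set.range (a i).state ⊆ S := fun i g hg =>
    Or.inr (Set.mem_iUnion.2 ⟨i, Or.inl hg⟩)
  have hsb : ∀ i, Set.range (b i).state ⊆ S := fun i g hg =>
    Or.inr (Set.mem_iUnion.2 ⟨i, Or.inr hg⟩)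
  have hca : ∀ i, (Set.range (a i).state).ncard ≤ s := fun i =>
    (Set.ncard_le_ncard (hsa i) hfin).trans hcard
  have hcb : ∀ i, (Set.range (b i).state).ncard ≤ s := fun i =>
    (Set.ncard_le_ncard (hsb i) hfin).trans hcard
  have hclosed : ∀ g ∈ S, ∀ x, g.state [x] ∈ S := by
    rintro g (rfl | hg) x
    · rw [state_one]
      exact Set.mem_insert _ _
    · obtain ⟨i, ⟨v, rfl⟩ | ⟨v, rfl⟩⟩ := Set.mem_iUnion.1 hg
      · exact hsa i ⟨v ++ [x], state_append _ _ _⟩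
      · exact hsb i ⟨v ++ [x], state_append _ _ _⟩
  refine ⟨fun i => ⟨hca i, hcb i⟩, fun h hh H => ?_⟩
  obtain ⟨C, hC⟩ := hh.exists_supp_le
  obtain ⟨h₁, H₁, hC₁, hR⟩ := exists_conj_levelStates H
    (fun i n => (ha i).ncard_supp_le (hca i) n) (fun i n => (hb i).ncard_supp_le (hcb i) n)
  rw [Fintype.card_fin] at hR
  obtain ⟨h', hb', H', hn⟩ := exists_isBounded_conj hfin hclosed
    (fun i => hsa i ⟨[], state_nil _⟩) (fun i => hsb i ⟨[], state_nil _⟩) H₁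
    (fun n => (hC₁ n).trans (hC n)) hR
  refine ⟨h', hb', H', hn.trans ?_⟩
  have hE := card_eqSystem_le hfin hcard (4 * k * (d + 1) ^ (2 * s))
  rw [Nat.card_prod, Nat.card_prod, Nat.card_eq_fintype_card (α := Set (Fin _)),
    Fintype.card_set, Fintype.card_fin]
  rw [conjugatorBound, unknownBound]
  gcongr

end TreeAut

/-! ### The decision procedure -/

open AutomatonCode TreeAut

theorem mainTheorem4 :
    ∃ f : ℕ × List (AutomatonCode × AutomatonCode) → Bool, Computable f ∧
      ∀ (d k : ℕ) (a b : Fin k → PolZero d) (A B : Fin k → AutomatonCode),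
        (∀ i, AutomatonCode.Represents (A i) (a i : TreeAut d)) →
        (∀ i, AutomatonCode.Represents (B i) (b i : TreeAut d)) →
        (f (d, List.ofFn fun i => (A i, B i)) = true ↔
          ∃ h : PolZero d, ∀ i, h⁻¹ * a i * h = b i) := by
  let s : ℕ × List (AutomatonCode × AutomatonCode) → ℕ := fun p => codeBound p.2
  let m : ℕ × List (AutomatonCode × AutomatonCode) → ℕ := fun p =>
    conjugatorBound (s p) (unknownBound p.1 p.2.length (s p))
  -- `N` is the activity bound satisfied by every bounded automorphism with at most `m` states. The
  -- tables have `m + 1` rows because of the trivial row `0`, and the final `+ 1` in `T` compensates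
  -- for the strict bound on the tested levels.
  let N : ℕ × List (AutomatonCode × AutomatonCode) → ℕ := fun p => (p.1 + 1) ^ (2 * m p)
  let T : ℕ × List (AutomatonCode × AutomatonCode) → ℕ := fun p => (m p + 1) * (N p + 2) + 1
  let L : ℕ × List (AutomatonCode × AutomatonCode) → ℕ := fun p =>
    (m p + 1) * s p * (s p * (m p + 1))
  have hs : Primrec s := primrec_codeBound.comp Primrec.snd
  have hm : Primrec m := primrec_conjugatorBound hs
    (primrec_unknownBound Primrec.fst (Primrec.list_length.comp Primrec.snd) hs)
  have hN : Primrec N := Primrec.nat_pow.comp (Primrec.succ.comp Primrec.fst)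
    (Primrec.nat_mul.comp (Primrec.const 2) hm)
  have hm1 : Primrec fun p => m p + 1 := Primrec.succ.comp hm
  have hT : Primrec T := Primrec.succ.comp (Primrec.nat_mul.comp hm1
    (Primrec.nat_add.comp hN (Primrec.const 2)))
  have hL : Primrec L := Primrec.nat_mul.comp (Primrec.nat_mul.comp hm1 hs)
    (Primrec.nat_mul.comp hs hm1)
  have hP : PrimrecPred fun p : ℕ × List (AutomatonCode × AutomatonCode) =>
      ∃ H ∈ tables p.1 (m p + 1), ∃ t < m p + 1,
        IsCertificate p.1 (m p + 1) (N p) (T p) (L p) p.2 H t := by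
    refine PrimrecPred.exists_mem (primrec_tables Primrec.fst hm1)
      (PrimrecPred.exists_lt' (hm1.comp Primrec.fst) ?_)
    have hp : Primrec fun q : ((ℕ × List (AutomatonCode × AutomatonCode)) ×
        List (List (ℕ × ℕ))) × ℕ => q.1.1 := Primrec.fst.comp Primrec.fst
    exact primrecPred_isCertificate (Primrec.fst.comp hp) (hm1.comp hp) (hN.comp hp)
      (hT.comp hp) (hL.comp hp) (Primrec.snd.comp hp) (Primrec.snd.comp Primrec.fst) Primrec.snd
  obtain ⟨hdec, hf⟩ := hP
  refine ⟨_, hf.to_comp, fun d k a b A B hA hB => ?_⟩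
  obtain ⟨hcard, hex⟩ := exists_conj_of_codes hA hB (fun i => (a i).2) (fun i => (b i).2) le_rfl
  have hm' : m (d, List.ofFn fun i => (A i, B i)) =
      conjugatorBound (codeBound (List.ofFn fun i => (A i, B i)))
        (unknownBound d k (codeBound (List.ofFn fun i => (A i, B i)))) := by
    simp only [m, s, List.length_ofFn]
  rw [decide_eq_true_iff]
  constructor
  · rintro ⟨H, hH, t, ht, hc⟩
    obtain ⟨h, hb, hconj⟩ := hc.exists_isBounded hA hB (fun i => (hcard i).1)
      (fun i => (hcard i).2) hH ht (Nat.lt_succ_self _) le_rfl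
    refine ⟨⟨h, hb⟩, fun i => Subtype.ext ?_⟩
    change h⁻¹ * (a i : TreeAut d) * h = b i
    rw [mul_assoc, ← hconj i, inv_mul_cancel_left]
  · rintro ⟨h, hh⟩
    have hconj : ∀ i, (h : TreeAut d) * (b i : TreeAut d) = (a i : TreeAut d) * h := fun i => by
      rw [← hh i]
      change (h : TreeAut d) * ((h : TreeAut d)⁻¹ * (a i : TreeAut d) * h) = _
      rw [mul_assoc, mul_inv_cancel_left]
    obtain ⟨h', hb', hconj', hn⟩ := hex h h.2 hconj
    rw [← hm'] at hn
    exact exists_isCertificate _ _ hA hB hb' hn le_rfl hconj'
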